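/- Let $n\ge 2$. For a finite set $X\subset\mathbb R^n$ with a weight function $w:X\to\mathbb R_{>0}$, let $S_1,\dots,S_p$ be the spheres centred at the origin that meet $X$ (the sphere of radius $0$ being $\{\boldsymbol 0\}$), and put $X_i=X\cap S_i$, $w(X_i)=\sum_{\boldsymbol x\in X_i}w(\boldsymbol x)$ and $S=S_1\cup\dots\cup S_p$; we say that $X$ is supported by $p$ concentric spheres. The pair $(X,w)$ is a Euclidean $9$-design if $$\sum_{i=1}^p\frac{w(X_i)}{|S_i|}\int_{S_i}f\,d\sigma_i=\sum_{\boldsymbol x\in X}w(\boldsymbol x)f(\boldsymbol x)$$ for every real polynomial $f$ in $n$ variables of degree at most $9$, where $\sigma_i$ is the surface measure on $S_i$ and $|S_i|$ its total mass (for $S_i=\{\boldsymbol 0\}$ the normalized integral is $f(\boldsymbol 0)$). Let $\mathcal P_4^*(\mathbb R^n)$ be the space of real polynomials all of whose terms have degree $0$, $2$ or $4$, and $\mathcal P_4^*(S)$ the space of restrictions of its elements to $S$. A Euclidean $9$-design $(X,w)$ with $\boldsymbol 0\in X$ is a tight $9$-design of $\mathbb R^n$ if $|X|=2\dim\mathcal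 P_4^*(S)-1$ and the restriction map $\mathcal P_4^*(\mathbb R^n)\to\mathcal P_4^*(S)$ is injective. **Corollary 1.2.** Let $n\ge 2$ and let $(X,w)$ be a tight $9$-design of $\mathbb R^n$ with $\boldsymbol 0\in X$. Then $n=2$, $X$ is supported by exactly $3$ concentric spheres (the origin and two circles), and there are real numbers $r_1,r_2,w_1>0$ with $r_1\ne r_2$ such that $(X\setminus\{\boldsymbol 0\},w)$ is similar to $(Y_1\cup Y_2,v)$, where $$Y_1=\Big\{r_1\big(\cos\tfrac{2k\pi}{8},\sin\tfrac{2k\pi}{8}\big)\ \Big|\ 0\le k\le 7\Big\},\qquad Y_2=\Big\{r_2\big(\cos\tfrac{(2k+1)\pi}{8},\sin\tfrac{(2k+1)\pi}{8}\big)\ \Big|\ 0\le k\le 7\Big\},$$ and $v=w_1$ on $Y_1$, $v=\frac{r_1^8}{r_2^8}w_1$ on $Y_2$. Here similar means that one weighted set is obtained from the other by an orthogonal transformation, a dilation by a positive factor, and multiplication of all weights by a positive constant. -/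

import Mathlib

namespace EuclideanDesign

/-- `ℝⁿ` with the Euclidean norm. -/
abbrev Rn (n : ℕ) : Type := EuclideanSpace ℝ (Fin n)

/-- The restriction map `f ↦ f|_S` from real polynomials in `n` variables to functions on `S`. -/
noncomputable def restrict {n : ℕ} (S : Set (Rn n)) :
    MvPolynomial (Fin n) ℝ →ₗ[ℝ] (S → ℝ) where
  toFun f := fun x => MvPolynomial.eval (fun i => x.1 i) f
  map_add' f g := by ext x; simp
  map_smul' c f := by ext x; simp

/-- `𝒫_e(ℝⁿ)`: the polynomials of degree at most `e`. -/
noncomputable def polys (n e : ℕ) : Submodule ℝ (MvPolynomial (Fin n) ℝ) :=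
  MvPolynomial.restrictTotalDegree (Fin n) ℝ e

/-- `𝒫*_e(ℝⁿ) = ⨁_{l = 0}^{⌊e/2⌋} Hom_{e-2l}(ℝⁿ)`: the polynomials all of whose terms have degree
at most `e` and of the same parity as `e`. -/
noncomputable def parityPolys (n e : ℕ) : Submodule ℝ (MvPolynomial (Fin n) ℝ) :=
  ⨆ l ∈ Finset.range (e / 2 + 1), MvPolynomial.homogeneousSubmodule (Fin n) ℝ (e - 2 * l)

/-- The union `S` of all spheres centred at the origin that meet `X`
(the sphere of radius `0` being `{0}`). -/
def support {n : ℕ} (X : Finset (Rn n)) : Set (Rn n) :=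
  {y | ∃ x ∈ X, ‖y‖ = ‖x‖}

/-- The number `p` of concentric spheres centred at the origin that support `X`. -/
noncomputable def numSpheres {n : ℕ} (X : Finset (Rn n)) : ℕ :=
  (X.image fun x => ‖x‖).card

/-- The normalized surface integral `|S_r|⁻¹ ∫_{S_r} f dσ` over the sphere of radius `r` centred
at the origin, written as an average over the unit sphere with respect to its surface measure.
For `r = 0` this is `f 0` (in dimension at least one). -/
noncomputable def sphereAverage {n : ℕ} (r : ℝ) (f : MvPolynomial (Fin n) ℝ) : ℝ :=
  ⨍ u : Metric.sphere (0 : Rn n) 1,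
    MvPolynomial.eval (fun i => (r • (u : Rn n)) i) f
      ∂((MeasureTheory.volume : MeasureTheory.Measure (Rn n)).toSphere)

/-- `(X, w)` is a Euclidean `t`-design: a positively weighted finite set with
`∑_i w(X_i) |S_i|⁻¹ ∫_{S_i} f dσ_i = ∑_{x ∈ X} w(x) f(x)` for all polynomials `f` of degree at
most `t`, where the `S_i` are the spheres centred at the origin that meet `X`, and
`X_i = X ∩ S_i`. Only the values of `w` on `X` matter. -/
def IsDesign {n : ℕ} (t : ℕ) (X : Finset (Rn n)) (w : Rn n → ℝ) : Prop :=
  (∀ x ∈ X, 0 < w x) ∧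
    ∀ f : MvPolynomial (Fin n) ℝ, f.totalDegree ≤ t →
      ∑ r ∈ X.image (fun x => ‖x‖), (∑ x ∈ X with ‖x‖ = r, w x) * sphereAverage r f =
        ∑ x ∈ X, w x * MvPolynomial.eval (fun i => x i) f

/-- The space of polynomials entering the Fisher type lower bound for `t`-designs:
`𝒫_e` if `t = 2e`, and `𝒫*_e` if `t = 2e + 1`. -/
noncomputable def boundPolys (n t : ℕ) : Submodule ℝ (MvPolynomial (Fin n) ℝ) :=
  if Even t then polys n (t / 2) else parityPolys n (t / 2)

open Classical in
/-- The Fisher type (Möller) lower bound for the size of a `t`-design on the spheres that support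
`X`: `dim 𝒫_e(S)` if `t = 2e`; if `t = 2e + 1`, `2 dim 𝒫*_e(S) - 1` when `e` is even and `0 ∈ X`,
and `2 dim 𝒫*_e(S)` otherwise. -/
noncomputable def lowerBound {n : ℕ} (t : ℕ) (X : Finset (Rn n)) : ℕ :=
  let d := Module.finrank ℝ ((boundPolys n t).map (restrict (support X)))
  if Even t then d
  else if Even (t / 2) ∧ (0 : Rn n) ∈ X then 2 * d - 1
  else 2 * d

/-- `(X, w)` is a tight `t`-design on `numSpheres X` concentric spheres. -/
def IsTightOnSpheres {n : ℕ} (t : ℕ) (X : Finset (Rn n)) (w : Rn n → ℝ) : Prop :=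
  IsDesign t X w ∧ X.card = lowerBound t X

/-- `(X, w)` is a tight `t`-design of `ℝⁿ`: moreover `𝒫_e(S) = 𝒫_e(ℝⁿ)` (if `t = 2e`), respectively
`𝒫*_e(S) = 𝒫*_e(ℝⁿ)` (if `t = 2e + 1`), in the sense that restriction to `S` is injective on that
space of polynomials. -/
def IsTightOfSpace {n : ℕ} (t : ℕ) (X : Finset (Rn n)) (w : Rn n → ℝ) : Prop :=
  IsTightOnSpheres t X w ∧ Set.InjOn (restrict (support X)) (boundPolys n t)

/-- Similarity of weighted sets: `(X, w)` is the image of `(Y, v)` under a linear isometry followed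
by a dilation, with the weights multiplied by a positive constant. For `m = n` the isometry is an
orthogonal transformation of `ℝⁿ`. -/
def Similar {m n : ℕ} (X : Set (Rn n)) (w : Rn n → ℝ) (Y : Set (Rn m)) (v : Rn m → ℝ) : Prop :=
  ∃ (σ : Rn m ≃ₗᵢ[ℝ] Rn n) (c μ : ℝ), 0 < c ∧ 0 < μ ∧
    X = (fun y => c • σ y) '' Y ∧ ∀ y ∈ Y, w (c • σ y) = μ * v y

/-- The regular `8`-gon `{r (cos (2kπ/8), sin (2kπ/8)) | 0 ≤ k ≤ 7}`. -/
def octagon₁ (r : ℝ) : Set (Rn 2) :=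
  {y | ∃ k : ℕ, k ≤ 7 ∧
    y = r • !₂[Real.cos (2 * k * Real.pi / 8), Real.sin (2 * k * Real.pi / 8)]}

/-- The rotated regular `8`-gon `{r (cos ((2k+1)π/8), sin ((2k+1)π/8)) | 0 ≤ k ≤ 7}`. -/
def octagon₂ (r : ℝ) : Set (Rn 2) :=
  {y | ∃ k : ℕ, k ≤ 7 ∧
    y = r • !₂[Real.cos ((2 * k + 1) * Real.pi / 8), Real.sin ((2 * k + 1) * Real.pi / 8)]}

open Classical in
/-- The weight on `octagon₁ r₁ ∪ octagon₂ r₂`: `w₁` on the first `8`-gon and `(r₁⁸ / r₂⁸) w₁` on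
the second. -/
noncomputable def octagonWeight (r₁ r₂ w₁ : ℝ) (y : Rn 2) : ℝ :=
  if y ∈ octagon₁ r₁ then w₁ else r₁ ^ 8 / r₂ ^ 8 * w₁

end EuclideanDesign

/-! Let d be the dimension of the space of even quartics, so that |X| = 2d - 1, and let l be a
linear form without zeros on X \ {0}. Exactness in odd degree makes f and l g orthogonal on X for
all even quartics f and g. Hence (f, g) ↦ f + l g has a kernel of dimension one on X and is onto
(`Tight.pairEval_surjective`). The kernel supplies a quartic that vanishes on X except at the
origin. Testing the design with it leaves at most two positive radii, and injectivity of the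
restriction requires two (`Tight.exists_radii`). Surjectivity makes the quartics on X \ {0} stable
under multiplication by quotients ⟪a, ·⟫ / ⟪l, ·⟫, so they contain indicators of lines, and X is
antipodal with equal weights at x and -x (`Tight.antipodal`).

Each shell integrates even powers up to degree 6 by itself, while in degree 8 only the two shells
together do. The reproducing kernel at x is therefore `share * zonal₄ + zonal₂` on the shell of x
and a multiple of `zonal₄` on the other shell. In its reproducing identity the terms at x and -x
alone give `2 * w x * diag ≤ mass`, so a shell has at least `2 * diag` points. The two diagonals sum
to at least d - 1, so equality holds throughout: weights are constant on shells and the kernel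
vanishes at all points other than x and -x (`Shells.kernel_eq_zero`).

In the plane, integrality of half the shell size gives `share = 1 / 2`, and the zeros of the kernel
are the angles of the two octagons (`Shells.similar`).

For n ≥ 3, the squared cosines between the shells satisfy a quadratic equation whose roots must be
rational, which forces (n + 1)(n + 2) = 6t² (`Shells.exists_mul_eq`). The two squared cosines within
a shell define a sign matrix with a rational, hence integral, eigenvalue y, tied by `EigenRel` to a
parameter a of the shell (`Shells.exists_int`). The two parameters sum to (n + 6)/12. The larger one
forces y = t + 1; the other would need an integer near t + 2 + √6, strictly between t + 4 and t + 5
(between 15 and 16 if n = 23), which is absurd (`not_eigenRel`). -/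

namespace EuclideanDesign

open MeasureTheory Metric
open scoped RealInnerProductSpace Pointwise

/-! ### Moments of linear forms on the unit sphere -/

/-- The surface measure on the unit sphere of `ℝⁿ`. -/
noncomputable abbrev surf (n : ℕ) : Measure (sphere (0 : Rn n) 1) :=
  (volume : Measure (Rn n)).toSphere

/-- A linear isometry acting on the unit sphere. -/
noncomputable def sphereMap {n : ℕ} (σ : Rn n ≃ₗᵢ[ℝ] Rn n) :
    sphere (0 : Rn n) 1 ≃ₜ sphere (0 : Rn n) 1 where
  toFun u := ⟨σ u, by simp⟩
  invFun u := ⟨σ.symm u, by simp⟩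
  left_inv u := by ext1; simp
  right_inv u := by ext1; simp
  continuous_toFun := by fun_prop
  continuous_invFun := by fun_prop

@[simp] lemma coe_sphereMap {n : ℕ} (σ : Rn n ≃ₗᵢ[ℝ] Rn n) (u : sphere (0 : Rn n) 1) :
    (sphereMap σ u : Rn n) = σ u := rfl

/-- The surface measure of a set is a multiple of the volume of the cone over it, and σ maps cones
to cones and preserves volume. -/
lemma measurePreserving_sphereMap {n : ℕ} (σ : Rn n ≃ₗᵢ[ℝ] Rn n) :
    MeasurePreserving (sphereMap σ) (surf n) (surf n) := by
  refine ⟨(sphereMap σ).continuous.measurable, ?_⟩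
  ext s hs
  rw [Measure.map_apply (sphereMap σ).continuous.measurable hs,
    Measure.toSphere_apply' _ ((sphereMap σ).continuous.measurable hs),
    Measure.toSphere_apply' _ hs]
  congr 1
  have hset : Set.Ioo (0 : ℝ) 1 • ((↑) '' (sphereMap σ ⁻¹' s) : Set (Rn n)) =
      σ ⁻¹' (Set.Ioo (0 : ℝ) 1 • ((↑) '' s : Set (Rn n))) := by
    ext x
    simp only [Set.mem_smul, Set.mem_image, Set.mem_preimage]
    constructor
    · rintro ⟨t, ht, _, ⟨u, hu, rfl⟩, rfl⟩
      exact ⟨t, ht, _, ⟨_, hu, rfl⟩, by simp⟩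
    · rintro ⟨t, ht, _, ⟨u, hu, rfl⟩, h⟩
      refine ⟨t, ht, _, ⟨(sphereMap σ).symm u, by simpa using hu, rfl⟩, ?_⟩
      apply σ.injective
      rw [← h]
      simp only [map_smul]
      congr 1
      exact congrArg Subtype.val ((sphereMap σ).apply_symm_apply u)
  rw [hset]
  exact σ.measurePreserving.measure_preimage_equiv (f := σ.toMeasurableEquiv) _

lemma average_sphereMap {n : ℕ} (σ : Rn n ≃ₗᵢ[ℝ] Rn n) (g : sphere (0 : Rn n) 1 → ℝ) :
    ⨍ u, g (sphereMap σ u) ∂surf n = ⨍ u, g u ∂surf n := by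
  rw [average_eq, average_eq,
    (measurePreserving_sphereMap σ).integral_comp (sphereMap σ).measurableEmbedding]

lemma integrable_sphere {n : ℕ} {g : sphere (0 : Rn n) 1 → ℝ} (hg : Continuous g) :
    Integrable g (surf n) :=
  hg.integrable_of_hasCompactSupport (HasCompactSupport.of_compactSpace g)

lemma average_add_sphere {n : ℕ} {f g : sphere (0 : Rn n) 1 → ℝ} (hf : Continuous f)
    (hg : Continuous g) :
    ⨍ u, (f u + g u) ∂surf n = ⨍ u, f u ∂surf n + ⨍ u, g u ∂surf n := by
  simp only [average_eq]
  rw [integral_add (integrable_sphere hf) (integrable_sphere hg), smul_add]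

lemma average_mul_const_sphere {n : ℕ} (c : ℝ) (f : sphere (0 : Rn n) 1 → ℝ) :
    ⨍ u, (c * f u) ∂surf n = c * ⨍ u, f u ∂surf n := by
  simp only [average_eq, smul_eq_mul]
  rw [integral_const_mul]
  ring

lemma average_sum_sphere {n : ℕ} {ι : Type*} (s : Finset ι) (f : ι → sphere (0 : Rn n) 1 → ℝ)
    (hf : ∀ i ∈ s, Continuous (f i)) :
    ⨍ u, (∑ i ∈ s, f i u) ∂surf n = ∑ i ∈ s, ⨍ u, f i u ∂surf n := by
  simp only [average_eq]
  rw [integral_finsetSum _ (fun i hi => integrable_sphere (hf i hi)), Finset.smul_sum]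

lemma average_const_sphere {n : ℕ} (hn : n ≠ 0) (c : ℝ) : ⨍ _, c ∂surf n = c := by
  have : Nonempty (Fin n) := ⟨⟨0, Nat.pos_of_ne_zero hn⟩⟩
  have : NeZero (surf n) := ⟨Measure.toSphere_ne_zero _⟩
  exact average_const _ _

lemma measureReal_surf_pos {n : ℕ} (hn : n ≠ 0) : 0 < (surf n).real Set.univ := by
  have : Nonempty (Fin n) := ⟨⟨0, Nat.pos_of_ne_zero hn⟩⟩
  have : NeZero (surf n) := ⟨Measure.toSphere_ne_zero _⟩
  exact measureReal_univ_pos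

lemma eq_zero_of_average_sq {n : ℕ} (hn : n ≠ 0) {g : sphere (0 : Rn n) 1 → ℝ} (hg : Continuous g)
    (h : ⨍ u, g u ^ 2 ∂surf n = 0) : g = 0 := by
  rw [average_eq, smul_eq_mul, mul_eq_zero, or_iff_right (inv_ne_zero (measureReal_surf_pos hn).ne'),
    integral_eq_zero_iff_of_nonneg (fun u => sq_nonneg (g u)) (integrable_sphere (hg.pow 2))] at h
  have := (Continuous.ae_eq_iff_eq (surf n) (hg.pow 2) continuous_const).1 h
  ext u
  have hu : g u ^ 2 = 0 := congrFun this u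
  simpa using hu

lemma average_sq_nonneg {n : ℕ} (g : sphere (0 : Rn n) 1 → ℝ) :
    0 ≤ ⨍ u, g u ^ 2 ∂surf n := by
  rw [average_eq, smul_eq_mul]
  exact mul_nonneg (by positivity) (integral_nonneg fun u => sq_nonneg (g u))

/-- The average of `⟪a, u⟫ᵏ` over the unit sphere only depends on the norm of `a`. -/
lemma average_inner_pow_eq_of_norm_eq {n : ℕ} {a b : Rn n} (h : ‖a‖ = ‖b‖) (k : ℕ) :
    ⨍ u : sphere (0 : Rn n) 1, ⟪a, (u : Rn n)⟫ ^ k ∂surf n =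
      ⨍ u : sphere (0 : Rn n) 1, ⟪b, (u : Rn n)⟫ ^ k ∂surf n := by
  set σ : Rn n ≃ₗᵢ[ℝ] Rn n := Submodule.reflection (ℝ ∙ (a - b))ᗮ
  have hσ : σ a = b := Submodule.reflection_sub h
  rw [← average_sphereMap σ (fun u => ⟪b, (u : Rn n)⟫ ^ k)]
  congr 1
  ext u
  rw [coe_sphereMap, ← hσ, LinearIsometryEquiv.inner_map_map]

/-- The `k`-th even moment of a coordinate of the unit sphere of `ℝⁿ`. -/
noncomputable def moment (n : ℕ) : ℕ → ℝ
  | 0 => 1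
  | k + 1 => moment n k * (2 * k + 1) / (n + 2 * k)

lemma average_inner_pow_eq_norm_pow_mul {n : ℕ} (e a : Rn n) (he : ‖e‖ = 1) (k : ℕ) :
    ⨍ u : sphere (0 : Rn n) 1, ⟪a, (u : Rn n)⟫ ^ k ∂surf n =
      ‖a‖ ^ k * ⨍ u : sphere (0 : Rn n) 1, ⟪e, (u : Rn n)⟫ ^ k ∂surf n := by
  rw [average_inner_pow_eq_of_norm_eq (b := ‖a‖ • e) (by simp [norm_smul, he]),
    ← average_mul_const_sphere]
  congr 1
  ext u
  rw [real_inner_smul_left, mul_pow]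

/-- For orthonormal `e`, `b`, the mixed moment `⟪e, u⟫²ᵏ ⟪b, u⟫²` is expressed by a pure one. -/
lemma average_inner_pow_mul_inner_sq {n : ℕ} {e b : Rn n} (he : ‖e‖ = 1) (hb : ‖b‖ = 1)
    (heb : ⟪e, b⟫ = 0) (k : ℕ) :
    (2 * k + 1) * ⨍ u : sphere (0 : Rn n) 1, ⟪e, (u : Rn n)⟫ ^ (2 * k) * ⟪b, (u : Rn n)⟫ ^ 2 ∂surf n =
      ⨍ u : sphere (0 : Rn n) 1, ⟪e, (u : Rn n)⟫ ^ (2 * k + 2) ∂surf n := by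
  set c := ⨍ u : sphere (0 : Rn n) 1, ⟪e, (u : Rn n)⟫ ^ (2 * k + 2) ∂surf n with hc
  set d : ℕ → ℝ := fun i => ⨍ u : sphere (0 : Rn n) 1,
    ⟪e, (u : Rn n)⟫ ^ (2 * k + 2 - i) * ⟪b, (u : Rn n)⟫ ^ i ∂surf n with hd
  -- Both sides are the average of ⟪e + s b, u⟫^(2k+2) as polynomials in s, because ‖e + s b‖² = 1 +
  -- s². The coefficients of s² give the claim.
  have key : (∑ i ∈ Finset.range (2 * k + 2 + 1),
        Polynomial.C (d i * ((2 * k + 2).choose i : ℝ)) * Polynomial.X ^ i : Polynomial ℝ) =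
      Polynomial.C c * Polynomial.expand ℝ 2 ((1 + Polynomial.X) ^ (k + 1)) := by
    apply Polynomial.funext
    intro s
    have h1 := average_inner_pow_eq_norm_pow_mul e (e + s • b) he (2 * k + 2)
    have h2 : ‖e + s • b‖ ^ (2 * k + 2) = (1 + s ^ 2) ^ (k + 1) := by
      rw [show 2 * k + 2 = 2 * (k + 1) by ring, pow_mul, norm_add_sq_real, real_inner_smul_right,
        heb, norm_smul, he, hb]
      simp
    rw [h2, ← hc] at h1
    simp only [Polynomial.eval_finsetSum, Polynomial.eval_mul, Polynomial.eval_C,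
      Polynomial.eval_pow, Polynomial.eval_X, Polynomial.expand_eval, Polynomial.eval_add,
      Polynomial.eval_one]
    rw [mul_comm c, ← h1]
    have h3 : ∀ u : sphere (0 : Rn n) 1, ⟪e + s • b, (u : Rn n)⟫ ^ (2 * k + 2) =
        ∑ i ∈ Finset.range (2 * k + 2 + 1), (((2 * k + 2).choose i : ℝ) * s ^ i) *
          (⟪e, (u : Rn n)⟫ ^ (2 * k + 2 - i) * ⟪b, (u : Rn n)⟫ ^ i) := by
      intro u
      rw [inner_add_left, real_inner_smul_left, add_comm, add_pow]
      refine Finset.sum_congr rfl fun i _ => ?_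
      rw [mul_pow]
      ring
    simp only [h3]
    rw [average_sum_sphere _ _ (fun i _ => by fun_prop)]
    refine Finset.sum_congr rfl fun i _ => ?_
    rw [average_mul_const_sphere]
    ring
  have h := congrArg (fun p => Polynomial.coeff p 2) key
  simp only [Polynomial.finsetSum_coeff, Polynomial.coeff_C_mul, Polynomial.coeff_X_pow] at h
  have h4 : (Polynomial.expand ℝ 2 ((1 + Polynomial.X) ^ (k + 1))).coeff 2 = (k + 1 : ℝ) := by
    have := Polynomial.coeff_expand_mul (p := 2) (by norm_num)
      ((1 + Polynomial.X : Polynomial ℝ) ^ (k + 1)) 1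
    rw [one_mul] at this
    rw [this, Polynomial.coeff_one_add_X_pow]
    simp
  rw [h4] at h
  simp only [mul_ite, mul_one, mul_zero] at h
  rw [Finset.sum_ite_eq, if_pos (by simp), Nat.cast_choose_two] at h
  have hd2 : d 2 = ⨍ u : sphere (0 : Rn n) 1,
      ⟪e, (u : Rn n)⟫ ^ (2 * k) * ⟪b, (u : Rn n)⟫ ^ 2 ∂surf n := by
    simp [hd]
  rw [← hd2]
  have hk : (k + 1 : ℝ) ≠ 0 := by positivity
  apply mul_right_cancel₀ hk
  rw [← h]
  push_cast
  ring

lemma average_inner_pow_unit {n : ℕ} (hn : n ≠ 0) {e : Rn n} (he : ‖e‖ = 1) (k : ℕ) :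
    ⨍ u : sphere (0 : Rn n) 1, ⟪e, (u : Rn n)⟫ ^ (2 * k) ∂surf n = moment n k := by
  induction k with
  | zero => simpa [moment] using average_const_sphere hn 1
  | succ k ih =>
    obtain ⟨v, b, hv, hb⟩ := (Orthonormal.exists_orthonormalBasis_extension (𝕜 := ℝ) (v := {e})
      (by rw [orthonormal_subtype_iff_ite]; rintro v rfl w rfl; simp [he]))
    have hev : e ∈ v := hv rfl
    set i₀ : v := ⟨e, hev⟩
    have hbi : ∀ i : v, b i = i := fun i => congrFun hb i
    have hcard : Fintype.card v = n := by
      rw [← Module.finrank_eq_card_basis b.toBasis]; simp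
    set M := ⨍ u : sphere (0 : Rn n) 1, ⟪e, (u : Rn n)⟫ ^ (2 * (k + 1)) ∂surf n with hM
    -- The factor 1 = ∑ ⟪b i, u⟫² is inserted into the moment of degree 2k. The term of `i₀` is M,
    -- and each of the other n - 1 terms is M / (2k + 1).
    have h1 : ∑ i : v, ⨍ u : sphere (0 : Rn n) 1,
        ⟪e, (u : Rn n)⟫ ^ (2 * k) * ⟪b i, (u : Rn n)⟫ ^ 2 ∂surf n = moment n k := by
      rw [← average_sum_sphere _ _ (fun i _ => by fun_prop), ← ih]
      congr 1
      ext u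
      rw [← Finset.mul_sum]
      have := b.sum_sq_norm_inner_right (u : Rn n)
      simp only [Real.norm_eq_abs, sq_abs] at this
      rw [this]
      simp
    rw [← Finset.add_sum_erase _ _ (Finset.mem_univ i₀)] at h1
    have h2 : ∀ i ∈ Finset.univ.erase i₀, ⨍ u : sphere (0 : Rn n) 1,
        ⟪e, (u : Rn n)⟫ ^ (2 * k) * ⟪b i, (u : Rn n)⟫ ^ 2 ∂surf n = M / (2 * k + 1) := by
      intro i hi
      have hk : (2 * k + 1 : ℝ) ≠ 0 := by positivity
      rw [eq_div_iff hk, mul_comm]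
      refine average_inner_pow_mul_inner_sq he (b.orthonormal.1 i) ?_ k
      have : b i₀ = e := hbi i₀
      rw [← this]
      exact b.orthonormal.2 (Finset.ne_of_mem_erase hi).symm
    have h3 : ⨍ u : sphere (0 : Rn n) 1,
        ⟪e, (u : Rn n)⟫ ^ (2 * k) * ⟪b i₀, (u : Rn n)⟫ ^ 2 ∂surf n = M := by
      rw [hM, hbi i₀]
      congr 1
      ext u
      ring
    rw [h3, Finset.sum_congr rfl h2, Finset.sum_const, Finset.card_erase_of_mem (Finset.mem_univ _),
      Finset.card_univ, hcard, nsmul_eq_mul, Nat.cast_sub (Nat.one_le_iff_ne_zero.2 hn)] at h1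
    have hn' : (0 : ℝ) < n := by positivity
    have hk : (2 * k + 1 : ℝ) ≠ 0 := by positivity
    have hnk : (n + 2 * k : ℝ) ≠ 0 := by positivity
    rw [moment, ← h1]
    push_cast
    field_simp
    ring

/-- The even moments of linear forms on the unit sphere. -/
lemma average_inner_pow {n : ℕ} (hn : n ≠ 0) (a : Rn n) (k : ℕ) :
    ⨍ u : sphere (0 : Rn n) 1, ⟪a, (u : Rn n)⟫ ^ (2 * k) ∂surf n = moment n k * ‖a‖ ^ (2 * k) := by
  have he : ‖(EuclideanSpace.single ⟨0, Nat.pos_of_ne_zero hn⟩ 1 : Rn n)‖ = 1 := by simp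
  rw [average_inner_pow_eq_norm_pow_mul _ a he, average_inner_pow_unit hn he, mul_comm]

/-! ### Polynomials and their sphere averages -/

/-- The value of a polynomial at a point of `ℝⁿ`. -/
noncomputable abbrev evalAt {n : ℕ} (x : Rn n) (f : MvPolynomial (Fin n) ℝ) : ℝ :=
  MvPolynomial.eval (fun i => x i) f

/-- The linear form `⟪a, ·⟫` as a polynomial. -/
noncomputable def linPoly {n : ℕ} (a : Rn n) : MvPolynomial (Fin n) ℝ :=
  ∑ i, MvPolynomial.C (a i) * MvPolynomial.X i

/-- The polynomial `‖·‖²`. -/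
noncomputable def sqPoly (n : ℕ) : MvPolynomial (Fin n) ℝ :=
  ∑ i, MvPolynomial.X i ^ 2

lemma evalAt_linPoly {n : ℕ} (a x : Rn n) : evalAt x (linPoly a) = ⟪a, x⟫ := by
  simp [evalAt, linPoly, PiLp.inner_apply, mul_comm]

lemma evalAt_sqPoly {n : ℕ} (x : Rn n) : evalAt x (sqPoly n) = ‖x‖ ^ 2 := by
  simp [evalAt, sqPoly, EuclideanSpace.norm_sq_eq]

lemma isHomogeneous_linPoly {n : ℕ} (a : Rn n) : (linPoly a).IsHomogeneous 1 := by
  refine MvPolynomial.IsHomogeneous.sum _ _ _ fun i _ => ?_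
  simpa using (MvPolynomial.isHomogeneous_C (Fin n) (a i)).mul (MvPolynomial.isHomogeneous_X ℝ i)

lemma isHomogeneous_sqPoly (n : ℕ) : (sqPoly n).IsHomogeneous 2 :=
  MvPolynomial.IsHomogeneous.sum _ _ _ fun i _ => by
    simpa using (MvPolynomial.isHomogeneous_X ℝ i).pow 2

lemma evalAt_smul {n k : ℕ} {f : MvPolynomial (Fin n) ℝ} (hf : f.IsHomogeneous k) (r : ℝ)
    (x : Rn n) : evalAt (r • x) f = r ^ k * evalAt x f := by
  simp only [evalAt, MvPolynomial.eval_eq, Finset.mul_sum, PiLp.smul_apply, smul_eq_mul, mul_pow,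
    Finset.prod_mul_distrib]
  refine Finset.sum_congr rfl fun d hd => ?_
  have : ∏ i ∈ d.support, r ^ d i = r ^ k := by
    rw [Finset.prod_pow_eq_pow_sum, ← hf (MvPolynomial.mem_support_iff.1 hd),
      Finsupp.weight_apply, Finsupp.sum]
    simp
  rw [this]
  ring

lemma continuous_evalAt {n : ℕ} (f : MvPolynomial (Fin n) ℝ) :
    Continuous fun x : Rn n => evalAt x f :=
  (MvPolynomial.continuous_eval f).comp (by fun_prop)

lemma sphereAverage_eq {n : ℕ} (r : ℝ) (f : MvPolynomial (Fin n) ℝ) :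
    sphereAverage r f = ⨍ u : sphere (0 : Rn n) 1, evalAt (r • (u : Rn n)) f ∂surf n := rfl

lemma continuous_evalAt_smul {n : ℕ} (r : ℝ) (f : MvPolynomial (Fin n) ℝ) :
    Continuous fun u : sphere (0 : Rn n) 1 => evalAt (r • (u : Rn n)) f :=
  (continuous_evalAt f).comp (by fun_prop)

lemma sphereAverage_add {n : ℕ} (r : ℝ) (f g : MvPolynomial (Fin n) ℝ) :
    sphereAverage r (f + g) = sphereAverage r f + sphereAverage r g := by
  simp only [sphereAverage_eq, evalAt, map_add]
  exact average_add_sphere (continuous_evalAt_smul r f) (continuous_evalAt_smul r g)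

lemma sphereAverage_of_isHomogeneous {n k : ℕ} {f : MvPolynomial (Fin n) ℝ}
    (hf : f.IsHomogeneous k) (r : ℝ) : sphereAverage r f = r ^ k * sphereAverage 1 f := by
  simp only [sphereAverage_eq, evalAt_smul hf, one_pow, one_mul, average_mul_const_sphere]

/-- A polynomial takes out a factor that is constant on the sphere. -/
lemma sphereAverage_mul_of_const {n : ℕ} {r c : ℝ} (hr : 0 ≤ r) {f g : MvPolynomial (Fin n) ℝ}
    (hg : ∀ x : Rn n, ‖x‖ = r → evalAt x g = c) :
    sphereAverage r (g * f) = c * sphereAverage r f := by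
  simp only [sphereAverage_eq]
  rw [← average_mul_const_sphere]
  congr 1
  ext u
  rw [evalAt, map_mul, ← evalAt, hg _ (by simp [norm_smul, abs_of_nonneg hr])]

lemma sphereAverage_zero {n : ℕ} (hn : n ≠ 0) (f : MvPolynomial (Fin n) ℝ) :
    sphereAverage 0 f = evalAt (0 : Rn n) f := by
  simp only [sphereAverage_eq, zero_smul, average_const_sphere hn]

lemma sphereAverage_of_odd {n : ℕ} {f : MvPolynomial (Fin n) ℝ}
    (hf : ∀ x : Rn n, evalAt (-x) f = -evalAt x f) (r : ℝ) : sphereAverage r f = 0 := by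
  have h := average_sphereMap (n := n) (LinearIsometryEquiv.neg ℝ) fun u => evalAt (r • (u : Rn n)) f
  simp only [coe_sphereMap, LinearIsometryEquiv.coe_neg, smul_neg, hf] at h
  rw [sphereAverage_eq]
  have h2 := average_mul_const_sphere (-1) fun u : sphere (0 : Rn n) 1 => evalAt (r • (u : Rn n)) f
  simp only [neg_one_mul] at h2
  linarith

lemma sphereAverage_sq_nonneg {n : ℕ} (r : ℝ) (f : MvPolynomial (Fin n) ℝ) :
    0 ≤ sphereAverage r (f ^ 2) := by
  simp only [sphereAverage_eq, evalAt, map_pow]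
  exact average_sq_nonneg _

lemma eq_zero_of_sphereAverage_sq {n : ℕ} (hn : n ≠ 0) {r : ℝ}
    {f : MvPolynomial (Fin n) ℝ} (h : sphereAverage r (f ^ 2) = 0) {x : Rn n} (hx : ‖x‖ = r) :
    evalAt x f = 0 := by
  simp only [sphereAverage_eq, evalAt, map_pow] at h
  have h0 := eq_zero_of_average_sq hn (continuous_evalAt_smul r f) h
  by_cases hx0 : x = 0
  · have hr : r = 0 := by rw [← hx, hx0, norm_zero]
    have := congrFun h0 ⟨EuclideanSpace.single ⟨0, Nat.pos_of_ne_zero hn⟩ 1, by simp⟩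
    simpa [hr, hx0, evalAt] using this
  · have hr : r ≠ 0 := by rw [← hx]; exact norm_ne_zero_iff.2 hx0
    have := congrFun h0 ⟨r⁻¹ • x, by
      rw [mem_sphere_zero_iff_norm, norm_smul, norm_inv, Real.norm_eq_abs, ← hx, abs_norm,
        inv_mul_cancel₀ (norm_ne_zero_iff.2 hx0)]⟩
    simpa [smul_smul, hr, evalAt] using this

lemma sphereAverage_linPoly_pow {n : ℕ} (hn : n ≠ 0) (a : Rn n) (r : ℝ) (k : ℕ) :
    sphereAverage r (linPoly a ^ (2 * k)) = r ^ (2 * k) * (moment n k * ‖a‖ ^ (2 * k)) := by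
  have h := (isHomogeneous_linPoly a).pow (2 * k)
  rw [one_mul] at h
  rw [sphereAverage_of_isHomogeneous h, ← average_inner_pow hn a k]
  simp only [sphereAverage_eq, one_smul, map_pow, evalAt_linPoly]

/-! ### Even polynomials of degree at most four -/

lemma boundPolys_nine (n : ℕ) : boundPolys n 9 =
    MvPolynomial.homogeneousSubmodule (Fin n) ℝ 4 ⊔ MvPolynomial.homogeneousSubmodule (Fin n) ℝ 2 ⊔
      MvPolynomial.homogeneousSubmodule (Fin n) ℝ 0 := by
  have h : ¬ Even 9 := by decide
  rw [boundPolys, if_neg h, parityPolys]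
  simp only [Nat.reduceDiv, Nat.reduceAdd]
  apply le_antisymm
  · refine iSup₂_le fun l hl => ?_
    have : l = 0 ∨ l = 1 ∨ l = 2 := by simp at hl; omega
    rcases this with rfl | rfl | rfl
    · exact le_sup_of_le_left le_sup_left
    · exact le_sup_of_le_left le_sup_right
    · exact le_sup_right
  · refine sup_le (sup_le ?_ ?_) ?_
    · exact le_iSup₂_of_le 0 (by simp) le_rfl
    · exact le_iSup₂_of_le 1 (by simp) le_rfl
    · exact le_iSup₂_of_le 2 (by simp) le_rfl

lemma mem_boundPolys_nine {n : ℕ} {f : MvPolynomial (Fin n) ℝ} : f ∈ boundPolys n 9 ↔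
    ∃ f₄ f₂ f₀ : MvPolynomial (Fin n) ℝ, f₄.IsHomogeneous 4 ∧ f₂.IsHomogeneous 2 ∧
      f₀.IsHomogeneous 0 ∧ f = f₄ + f₂ + f₀ := by
  simp only [boundPolys_nine, Submodule.mem_sup, MvPolynomial.mem_homogeneousSubmodule]
  constructor
  · rintro ⟨_, ⟨f₄, h4, f₂, h2, rfl⟩, f₀, h0, rfl⟩
    exact ⟨f₄, f₂, f₀, h4, h2, h0, rfl⟩
  · rintro ⟨f₄, f₂, f₀, h4, h2, h0, rfl⟩
    exact ⟨_, ⟨f₄, h4, f₂, h2, rfl⟩, f₀, h0, rfl⟩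

lemma totalDegree_le_of_mem {n : ℕ} {f : MvPolynomial (Fin n) ℝ} (hf : f ∈ boundPolys n 9) :
    f.totalDegree ≤ 4 := by
  obtain ⟨f₄, f₂, f₀, h4, h2, h0, rfl⟩ := mem_boundPolys_nine.1 hf
  refine (MvPolynomial.totalDegree_add _ _).trans (max_le ((MvPolynomial.totalDegree_add _ _).trans
    (max_le h4.totalDegree_le (h2.totalDegree_le.trans ?_))) (h0.totalDegree_le.trans ?_)) <;> norm_num

lemma evalAt_neg_of_mem {n : ℕ} {f : MvPolynomial (Fin n) ℝ} (hf : f ∈ boundPolys n 9) (x : Rn n) :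
    evalAt (-x) f = evalAt x f := by
  obtain ⟨f₄, f₂, f₀, h4, h2, h0, rfl⟩ := mem_boundPolys_nine.1 hf
  have e4 := evalAt_smul h4 (-1) x
  have e2 := evalAt_smul h2 (-1) x
  have e0 := evalAt_smul h0 (-1) x
  simp only [neg_one_smul] at e4 e2 e0
  simp only [evalAt, map_add] at e4 e2 e0 ⊢
  rw [e4, e2, e0]
  norm_num

lemma sphereAverage_of_mem {n : ℕ} {f : MvPolynomial (Fin n) ℝ} (hf : f ∈ boundPolys n 9) :
    ∃ a b c : ℝ, ∀ r, sphereAverage r f = a + b * r ^ 2 + c * r ^ 4 := by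
  obtain ⟨f₄, f₂, f₀, h4, h2, h0, rfl⟩ := mem_boundPolys_nine.1 hf
  refine ⟨sphereAverage 1 f₀, sphereAverage 1 f₂, sphereAverage 1 f₄, fun r => ?_⟩
  rw [sphereAverage_add, sphereAverage_add, sphereAverage_of_isHomogeneous h4,
    sphereAverage_of_isHomogeneous h2, sphereAverage_of_isHomogeneous h0]
  ring

/-- The radial polynomial `a + b ‖x‖² + c ‖x‖⁴`. -/
noncomputable def radial (n : ℕ) (a b c : ℝ) : MvPolynomial (Fin n) ℝ :=
  MvPolynomial.C c * sqPoly n ^ 2 + MvPolynomial.C b * sqPoly n + MvPolynomial.C a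

lemma radial_mem (n : ℕ) (a b c : ℝ) : radial n a b c ∈ boundPolys n 9 := by
  refine mem_boundPolys_nine.2 ⟨_, _, _, ?_, ?_, MvPolynomial.isHomogeneous_C _ a, rfl⟩
  · simpa using (MvPolynomial.isHomogeneous_C (Fin n) c).mul ((isHomogeneous_sqPoly n).pow 2)
  · simpa using (MvPolynomial.isHomogeneous_C (Fin n) b).mul (isHomogeneous_sqPoly n)

lemma evalAt_radial {n : ℕ} (a b c : ℝ) (x : Rn n) :
    evalAt x (radial n a b c) = a + b * ‖x‖ ^ 2 + c * ‖x‖ ^ 4 := by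
  have := evalAt_sqPoly x
  simp only [evalAt] at this
  simp only [evalAt, radial, map_add, map_mul, map_pow, this, MvPolynomial.eval_C]
  ring

lemma finrank_homogeneousSubmodule_le (n k : ℕ) :
    Module.finrank ℝ (MvPolynomial.homogeneousSubmodule (Fin n) ℝ k) ≤ n.multichoose k := by
  classical
  have h : MvPolynomial.homogeneousSubmodule (Fin n) ℝ k ≤ Submodule.span ℝ
      (((Finset.univ : Finset (Fin n)).finsuppAntidiag k).image
        fun d => MvPolynomial.monomial d (1 : ℝ) : Finset (MvPolynomial (Fin n) ℝ)) := by
    intro f hf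
    rw [f.as_sum]
    refine Submodule.sum_mem _ fun d hd => ?_
    rw [← mul_one (MvPolynomial.coeff d f), ← smul_eq_mul, ← MvPolynomial.smul_monomial]
    refine Submodule.smul_mem _ _ (Submodule.subset_span ?_)
    simp only [Finset.coe_image, Set.mem_image, Finset.mem_coe, Finset.mem_finsuppAntidiag]
    refine ⟨d, ⟨?_, by simp⟩, rfl⟩
    have := hf (MvPolynomial.mem_support_iff.1 hd)
    rw [Finsupp.weight_apply, Finsupp.sum_fintype _ _ (by simp)] at this
    simpa using this
  calc _ ≤ _ := Submodule.finrank_mono h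
    _ ≤ _ := finrank_span_finset_le_card _
    _ ≤ _ := Finset.card_image_le
    _ = _ := by rw [Finset.card_finsuppAntidiag_nat_eq_multichoose]; simp

instance (n : ℕ) : FiniteDimensional ℝ (boundPolys n 9) := by
  rw [boundPolys_nine]
  have (k : ℕ) : FiniteDimensional ℝ (MvPolynomial.homogeneousSubmodule (Fin n) ℝ k) :=
    Module.Finite.iff_fg.2 (MvPolynomial.homogeneousSubmodule_fg _ _ _)
  infer_instance

/-- An upper bound suffices: it limits |X| from above, and the kernel estimate on the shells
supplies the matching lower bound. -/
lemma finrank_boundPolys_le (n : ℕ) : (Module.finrank ℝ (boundPolys n 9) : ℝ) ≤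
    n * (n + 1) * (n + 2) * (n + 3) / 24 + n * (n + 1) / 2 + 1 := by
  have h : Module.finrank ℝ (boundPolys n 9) ≤ n.multichoose 4 + n.multichoose 2 + n.multichoose 0 := by
    have (k : ℕ) : FiniteDimensional ℝ (MvPolynomial.homogeneousSubmodule (Fin n) ℝ k) :=
      Module.Finite.iff_fg.2 (MvPolynomial.homogeneousSubmodule_fg _ _ _)
    rw [boundPolys_nine]
    refine (Submodule.finrank_add_le_finrank_add_finrank _ _).trans (add_le_add
      ((Submodule.finrank_add_le_finrank_add_finrank _ _).trans (add_le_add ?_ ?_)) ?_) <;>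
    exact finrank_homogeneousSubmodule_le _ _
  have h' : (Module.finrank ℝ (boundPolys n 9) : ℝ) ≤
      n.multichoose 4 + n.multichoose 2 + n.multichoose 0 := by exact_mod_cast h
  refine h'.trans (le_of_eq ?_)
  rw [Nat.multichoose_eq, Nat.multichoose_eq, Nat.multichoose_zero_right]
  have e4 : ((n + 4 - 1).choose 4 : ℝ) = n * (n + 1) * (n + 2) * (n + 3) / 24 := by
    rw [show n + 4 - 1 = n + 3 by omega, Nat.cast_choose_eq_ascPochhammer_div]
    simp [ascPochhammer_succ_eval, Nat.factorial]
  have e2 : ((n + 2 - 1).choose 2 : ℝ) = n * (n + 1) / 2 := by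
    rw [show n + 2 - 1 = n + 1 by omega, Nat.cast_choose_two]
    push_cast
    ring
  rw [e4, e2]
  norm_num

/-! ### Design identities and tightness -/

lemma IsDesign.weight_pos {n : ℕ} {X : Finset (Rn n)} {w : Rn n → ℝ} {t : ℕ} (hD : IsDesign t X w)
    {x : Rn n} (hx : x ∈ X) : 0 < w x := hD.1 x hx

lemma sum_image_norm {n : ℕ} (X : Finset (Rn n)) (w : Rn n → ℝ) (F : ℝ → ℝ) :
    ∑ r ∈ X.image (fun x => ‖x‖), (∑ x ∈ X with ‖x‖ = r, w x) * F r = ∑ x ∈ X, w x * F ‖x‖ := by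
  rw [← Finset.sum_fiberwise_of_maps_to (s := X) (t := X.image (fun x => ‖x‖)) (g := fun x => ‖x‖)
    (fun x hx => Finset.mem_image_of_mem _ hx)]
  refine Finset.sum_congr rfl fun r _ => ?_
  rw [Finset.sum_mul]
  refine Finset.sum_congr rfl fun x hx => ?_
  rw [(Finset.mem_filter.1 hx).2]

lemma IsDesign.sum_average {n : ℕ} {X : Finset (Rn n)} {w : Rn n → ℝ} {t : ℕ} (hD : IsDesign t X w)
    {f : MvPolynomial (Fin n) ℝ} (hf : f.totalDegree ≤ t) :
    ∑ x ∈ X, w x * sphereAverage ‖x‖ f = ∑ x ∈ X, w x * evalAt x f := by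
  rw [← sum_image_norm X w fun r => sphereAverage r f]
  exact hD.2 f hf

lemma totalDegree_mul_le_of_le {n a b c : ℕ} {f g : MvPolynomial (Fin n) ℝ} (hf : f.totalDegree ≤ a)
    (hg : g.totalDegree ≤ b) (h : a + b ≤ c) : (f * g).totalDegree ≤ c :=
  (MvPolynomial.totalDegree_mul f g).trans ((add_le_add hf hg).trans h)

/-- Moments of linear forms with respect to a design. -/
lemma IsDesign.sum_inner_pow {n : ℕ} (hn : n ≠ 0) {X : Finset (Rn n)} {w : Rn n → ℝ} {t : ℕ}
    (hD : IsDesign t X w) (a : Rn n) {k j : ℕ} (hkj : 2 * k + 2 * j ≤ t) :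
    ∑ x ∈ X, w x * ((⟪a, x⟫ ^ (2 * k) - moment n k * ‖a‖ ^ (2 * k) * ‖x‖ ^ (2 * k)) *
      ‖x‖ ^ (2 * j)) = 0 := by
  have hdeg : (sqPoly n ^ j * linPoly a ^ (2 * k)).totalDegree ≤ t := by
    have h := ((isHomogeneous_sqPoly n).pow j).mul ((isHomogeneous_linPoly a).pow (2 * k))
    exact h.totalDegree_le.trans (by omega)
  have h := hD.sum_average hdeg
  have h1 : ∀ r : ℝ, 0 ≤ r → sphereAverage r (sqPoly n ^ j * linPoly a ^ (2 * k)) =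
      r ^ (2 * j) * (r ^ (2 * k) * (moment n k * ‖a‖ ^ (2 * k))) := by
    intro r hr
    rw [sphereAverage_mul_of_const hr (c := r ^ (2 * j)), sphereAverage_linPoly_pow hn]
    intro x hx
    rw [evalAt, map_pow, ← evalAt, evalAt_sqPoly, hx, ← pow_mul]
  have h2 : ∀ x : Rn n, evalAt x (sqPoly n ^ j * linPoly a ^ (2 * k)) =
      ‖x‖ ^ (2 * j) * ⟪a, x⟫ ^ (2 * k) := by
    intro x
    rw [evalAt, map_mul, map_pow, map_pow, ← evalAt, ← evalAt, evalAt_sqPoly, evalAt_linPoly,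
      ← pow_mul]
  simp only [h2] at h
  rw [Finset.sum_congr rfl fun x _ => by rw [h1 _ (norm_nonneg x)]] at h
  rw [← sub_eq_zero.2 h.symm, ← Finset.sum_sub_distrib]
  refine Finset.sum_congr rfl fun x _ => ?_
  ring

/-- What tightness means for a `9`-design that contains the origin. -/
structure Tight {n : ℕ} (X : Finset (Rn n)) (w : Rn n → ℝ) : Prop where
  ne_zero : n ≠ 0
  design : IsDesign 9 X w
  zero_mem : (0 : Rn n) ∈ X
  card_eq : X.card = 2 * Module.finrank ℝ (boundPolys n 9) - 1
  eq_zero : ∀ f ∈ boundPolys n 9, (∀ y ∈ support X, evalAt y f = 0) → f = 0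

lemma Tight.of_isTightOfSpace {n : ℕ} (hn : n ≠ 0) {X : Finset (Rn n)} {w : Rn n → ℝ}
    (h : IsTightOfSpace 9 X w) (h0 : (0 : Rn n) ∈ X) : Tight X w := by
  obtain ⟨⟨hD, hc⟩, hinj⟩ := h
  refine ⟨hn, hD, h0, ?_, ?_⟩
  · have h9 : ¬ Even 9 := by decide
    have h4 : Even (9 / 2) := by decide
    simp only [lowerBound, if_neg h9] at hc
    rw [if_pos ⟨h4, h0⟩, ← LinearMap.range_domRestrict, LinearMap.finrank_range_of_inj] at hc
    · exact hc
    · intro f g hfg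
      exact Subtype.ext (hinj f.2 g.2 hfg)
  · intro f hf hS
    refine hinj hf (Submodule.zero_mem _) ?_
    ext y
    simpa [restrict] using hS y.1 y.2

/-! ### Orthogonality of even and odd functions on X, and the radii -/

section structural

variable {n : ℕ} {X : Finset (Rn n)} {w : Rn n → ℝ}

/-- Since f² has degree at most 8, the sum is a positive combination of the averages of f² over the
spheres. So f vanishes on all of S, and injectivity applies. -/
lemma Tight.eq_zero_of_sum_sq (h : Tight X w) {f : MvPolynomial (Fin n) ℝ}
    (hf : f ∈ boundPolys n 9) (hs : ∑ x ∈ X, w x * evalAt x f ^ 2 = 0) : f = 0 := by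
  have hd : (f ^ 2).totalDegree ≤ 9 := by
    rw [sq]
    exact totalDegree_mul_le_of_le (totalDegree_le_of_mem hf) (totalDegree_le_of_mem hf) (by norm_num)
  have h1 := h.design.sum_average hd
  simp only [evalAt, map_pow] at h1 hs
  rw [hs, Finset.sum_eq_zero_iff_of_nonneg
    (fun x hx => mul_nonneg (h.design.weight_pos hx).le (sphereAverage_sq_nonneg _ _))] at h1
  refine h.eq_zero f hf ?_
  rintro y ⟨x, hx, hxy⟩
  have := h1 x hx
  rw [mul_eq_zero, or_iff_right (h.design.weight_pos hx).ne'] at this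
  exact eq_zero_of_sphereAverage_sq h.ne_zero this hxy

lemma Tight.eq_zero_of_eval (h : Tight X w) {f : MvPolynomial (Fin n) ℝ}
    (hf : f ∈ boundPolys n 9) (hs : ∀ x ∈ X, evalAt x f = 0) : f = 0 :=
  h.eq_zero_of_sum_sq hf (Finset.sum_eq_zero fun x hx => by rw [hs x hx]; simp)

/-- Even polynomials are orthogonal to their products with linear forms. -/
lemma Tight.sum_odd (h : Tight X w) (a : Rn n) {f g : MvPolynomial (Fin n) ℝ}
    (hf : f ∈ boundPolys n 9) (hg : g ∈ boundPolys n 9) :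
    ∑ x ∈ X, w x * (⟪a, x⟫ * evalAt x f * evalAt x g) = 0 := by
  have hd : (linPoly a * f * g).totalDegree ≤ 9 :=
    totalDegree_mul_le_of_le (totalDegree_mul_le_of_le (isHomogeneous_linPoly a).totalDegree_le
      (totalDegree_le_of_mem hf) le_rfl) (totalDegree_le_of_mem hg) (by norm_num)
  have hev : ∀ x : Rn n, evalAt x (linPoly a * f * g) = ⟪a, x⟫ * evalAt x f * evalAt x g := by
    intro x
    rw [← evalAt_linPoly]
    simp only [evalAt, map_mul]
  have h1 := h.design.sum_average hd
  simp only [hev] at h1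
  rw [← h1]
  refine Finset.sum_eq_zero fun x _ => ?_
  rw [sphereAverage_of_odd, mul_zero]
  intro y
  rw [hev, hev, evalAt_neg_of_mem hf, evalAt_neg_of_mem hg, inner_neg_right]
  ring

/-- Provides a linear form that can serve as a denominator on X \ {0}. -/
lemma exists_inner_ne_zero (X : Finset (Rn n)) : ∃ l : Rn n, ∀ x ∈ X, x ≠ 0 → ⟪l, x⟫ ≠ 0 := by
  obtain ⟨f, hf⟩ := Module.exists_dual_forall_apply_ne_zero (K := ℝ)
    (fun x : X.filter (· ≠ 0) => (x : Rn n)) (fun x => (Finset.mem_filter.1 x.2).2)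
  refine ⟨(InnerProductSpace.toDual ℝ (Rn n)).symm (LinearMap.toContinuousLinearMap f), ?_⟩
  intro x hx hx0
  simpa using hf ⟨x, Finset.mem_filter.2 ⟨hx, hx0⟩⟩

/-- The evaluation of `f + ⟪l, ·⟫ g` on `X`. -/
noncomputable def pairEval (X : Finset (Rn n)) (l : Rn n) :
    (boundPolys n 9 × boundPolys n 9) →ₗ[ℝ] (X → ℝ) where
  toFun p := fun x => evalAt x.1 p.1.1 + ⟪l, x.1⟫ * evalAt x.1 p.2.1
  map_add' p q := by ext x; simp [evalAt]; ring
  map_smul' c p := by ext x; simp [evalAt]; ring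

/-- By `Tight.sum_odd` the two summands are orthogonal in the weighted inner product on X, so each
vanishes on X when their sum does. -/
lemma Tight.of_pairEval_eq_zero (h : Tight X w) {l : Rn n} {p : boundPolys n 9 × boundPolys n 9}
    (hp : pairEval X l p = 0) : p.1 = 0 ∧ ∀ x ∈ X, ⟪l, x⟫ * evalAt x p.2.1 = 0 := by
  have hx : ∀ x ∈ X, evalAt x p.1.1 + ⟪l, x⟫ * evalAt x p.2.1 = 0 :=
    fun x hx => congrFun hp ⟨x, hx⟩
  have h1 : p.1.1 = 0 := by
    apply h.eq_zero_of_sum_sq p.1.2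
    have h2 := h.sum_odd l p.2.2 p.1.2
    rw [← neg_eq_zero, ← h2, ← Finset.sum_neg_distrib]
    refine Finset.sum_congr rfl fun x hxX => ?_
    have := hx x hxX
    linear_combination (-w x * evalAt x p.1.1) * this
  refine ⟨Subtype.ext h1, fun x hxX => ?_⟩
  have := hx x hxX
  rw [h1] at this
  simpa [evalAt] using this

lemma Tight.one_le_finrank (h : Tight X w) : 1 ≤ Module.finrank ℝ (boundPolys n 9) := by
  have := h.card_eq
  have := Finset.card_pos.2 ⟨_, h.zero_mem⟩
  omega

/-- There is an even quartic that vanishes on `X` except at the origin. -/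
lemma Tight.exists_separating_zero (h : Tight X w) : ∃ f ∈ boundPolys n 9,
    evalAt (0 : Rn n) f ≠ 0 ∧ ∀ x ∈ X, x ≠ 0 → evalAt x f = 0 := by
  obtain ⟨l, hl⟩ := exists_inner_ne_zero X
  have hlt : Module.finrank ℝ (X → ℝ) < Module.finrank ℝ (boundPolys n 9 × boundPolys n 9) := by
    rw [Module.finrank_prod, Module.finrank_fintype_fun_eq_card, Fintype.card_coe, h.card_eq]
    have := h.one_le_finrank
    omega
  obtain ⟨p, hp, hp0⟩ := (Submodule.ne_bot_iff _).1
    (LinearMap.ker_ne_bot_of_finrank_lt (f := pairEval X l) hlt)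
  obtain ⟨h1, h2⟩ := h.of_pairEval_eq_zero (LinearMap.mem_ker.1 hp)
  have h3 : ∀ x ∈ X, x ≠ 0 → evalAt x p.2.1 = 0 := fun x hx hx0 =>
    (mul_eq_zero.1 (h2 x hx)).resolve_left (hl x hx hx0)
  refine ⟨p.2.1, p.2.2, fun h4 => hp0 ?_, h3⟩
  refine Prod.ext h1 (Subtype.ext (h.eq_zero_of_eval p.2.2 fun x hx => ?_))
  by_cases hx0 : x = 0
  · rw [hx0, h4]
  · exact h3 x hx hx0

/-- A kernel element is a pair (0, g) with g zero on X \ {0}, hence determined by g(0). So the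
kernel has dimension at most 1, and the rank is at least 2d - 1 = |X|. -/
lemma Tight.pairEval_surjective (h : Tight X w) {l : Rn n} (hl : ∀ x ∈ X, x ≠ 0 → ⟪l, x⟫ ≠ 0) :
    Function.Surjective (pairEval X l) := by
  let ev0 : LinearMap.ker (pairEval X l) →ₗ[ℝ] ℝ :=
    { toFun := fun p => evalAt (0 : Rn n) p.1.2.1
      map_add' := fun p q => by simp [evalAt]
      map_smul' := fun c p => by simp [evalAt] }
  have hinj : Function.Injective ev0 := by
    intro p q hpq
    have hd : pairEval X l (p.1 - q.1) = 0 := by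
      rw [map_sub, LinearMap.mem_ker.1 p.2, LinearMap.mem_ker.1 q.2, sub_zero]
    have hd0 : evalAt (0 : Rn n) (p.1 - q.1).2.1 = 0 := by
      have : evalAt (0 : Rn n) p.1.2.1 = evalAt (0 : Rn n) q.1.2.1 := hpq
      simpa [evalAt, sub_eq_zero] using this
    obtain ⟨h1, h2⟩ := h.of_pairEval_eq_zero hd
    have h3 : (p.1 - q.1).2 = 0 :=
      Subtype.ext (h.eq_zero_of_eval (p.1 - q.1).2.2 fun x hx => by
        by_cases hx0 : x = 0
        · rw [hx0]; exact hd0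
        · exact (mul_eq_zero.1 (h2 x hx)).resolve_left (hl x hx hx0))
    exact Subtype.ext (sub_eq_zero.1 (Prod.ext h1 h3))
  have hk : Module.finrank ℝ (LinearMap.ker (pairEval X l)) ≤ 1 := by
    simpa using LinearMap.finrank_le_finrank_of_injective hinj
  have hr := LinearMap.finrank_range_add_finrank_ker (pairEval X l)
  rw [← LinearMap.range_eq_top]
  apply Submodule.eq_top_of_finrank_eq
  apply le_antisymm (Submodule.finrank_le _)
  rw [Module.finrank_prod] at hr
  rw [Module.finrank_fintype_fun_eq_card, Fintype.card_coe, h.card_eq]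
  omega

/-- The restrictions of even quartics to `X \ {0}` are closed under multiplication by quotients
of linear forms. -/
lemma Tight.exists_quotient (h : Tight X w) {l : Rn n} (hl : ∀ x ∈ X, x ≠ 0 → ⟪l, x⟫ ≠ 0)
    (a : Rn n) {f : MvPolynomial (Fin n) ℝ} (hf : f ∈ boundPolys n 9) :
    ∃ g ∈ boundPolys n 9, ∀ x ∈ X, x ≠ 0 → evalAt x g = ⟪a, x⟫ / ⟪l, x⟫ * evalAt x f := by
  obtain ⟨p, hp⟩ := h.pairEval_surjective hl fun x => ⟪a, x.1⟫ * evalAt x.1 f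
  have hx : ∀ x ∈ X, evalAt x p.1.1 + ⟪l, x⟫ * evalAt x p.2.1 = ⟪a, x⟫ * evalAt x f :=
    fun x hx => congrFun hp ⟨x, hx⟩
  -- On X, `p.1` is the difference of two products of a linear form with an even quartic, so it is
  -- orthogonal to itself.
  have h1 : p.1.1 = 0 := by
    apply h.eq_zero_of_sum_sq p.1.2
    have h2 := h.sum_odd l p.2.2 p.1.2
    have h3 := h.sum_odd a hf p.1.2
    rw [← sub_eq_zero.2 (h3.trans h2.symm), ← Finset.sum_sub_distrib]
    refine Finset.sum_congr rfl fun x hxX => ?_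
    have := hx x hxX
    linear_combination (w x * evalAt x p.1.1) * this
  refine ⟨p.2.1, p.2.2, fun x hxX hx0 => ?_⟩
  have := hx x hxX
  have hlx := hl x hxX hx0
  rw [h1, evalAt, map_zero, zero_add] at this
  rw [div_mul_eq_mul_div, eq_div_iff hlx, ← this, mul_comm]

/-- Only two positive radii occur in `X`. -/
lemma Tight.exists_radii (h : Tight X w) : ∃ r₁ r₂ : ℝ, 0 < r₁ ∧ 0 < r₂ ∧ r₁ ≠ r₂ ∧
    (∃ x ∈ X, ‖x‖ = r₁) ∧ (∃ x ∈ X, ‖x‖ = r₂) ∧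
    ∀ x ∈ X, x ≠ 0 → ‖x‖ = r₁ ∨ ‖x‖ = r₂ := by
  obtain ⟨f, hf, hf0, hfX⟩ := h.exists_separating_zero
  obtain ⟨a, b, c, habc⟩ := sphereAverage_of_mem hf
  have ha : a = evalAt (0 : Rn n) f := by
    have := habc 0
    rw [sphereAverage_zero h.ne_zero] at this
    simpa using this.symm
  -- The test polynomial is f times its own radial average q. The origin contributes w(0) a² to both
  -- sides, and f vanishes at all other points of X, so ∑ w(x) q(‖x‖)² = 0 over X \ {0}.
  have hroot : ∀ x ∈ X, x ≠ 0 → a + b * ‖x‖ ^ 2 + c * ‖x‖ ^ 4 = 0 := by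
    have hd : (radial n a b c * f).totalDegree ≤ 9 :=
      totalDegree_mul_le_of_le (totalDegree_le_of_mem (radial_mem n a b c))
        (totalDegree_le_of_mem hf) (by norm_num)
    have h1 := h.design.sum_average hd
    rw [Finset.sum_congr rfl fun x _ => by
      rw [sphereAverage_mul_of_const (norm_nonneg x)
        (fun y hy => (evalAt_radial a b c y).trans (by rw [hy])), habc],
      ← Finset.add_sum_erase _ _ h.zero_mem, ← Finset.add_sum_erase _ _ h.zero_mem] at h1
    have h2 : ∑ x ∈ X.erase 0, w x * evalAt x (radial n a b c * f) = 0 := by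
      refine Finset.sum_eq_zero fun x hx => ?_
      rw [evalAt, map_mul, ← evalAt, ← evalAt, hfX x (Finset.mem_of_mem_erase hx)
        (Finset.ne_of_mem_erase hx)]
      simp
    have h3 : evalAt (0 : Rn n) (radial n a b c * f) = a * a := by
      rw [evalAt, map_mul, ← evalAt, ← evalAt, evalAt_radial, ← ha]
      simp
    rw [h2, h3, norm_zero] at h1
    have h4 : ∑ x ∈ X.erase 0, w x * ((a + b * ‖x‖ ^ 2 + c * ‖x‖ ^ 4) *
        (a + b * ‖x‖ ^ 2 + c * ‖x‖ ^ 4)) = 0 := by linarith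
    rw [Finset.sum_eq_zero_iff_of_nonneg fun x hx => mul_nonneg
      (h.design.weight_pos (Finset.mem_of_mem_erase hx)).le (mul_self_nonneg _)] at h4
    intro x hx hx0
    have := h4 x (Finset.mem_erase.2 ⟨hx0, hx⟩)
    rw [mul_eq_zero, or_iff_right (h.design.weight_pos hx).ne'] at this
    exact mul_self_eq_zero.1 this
  rw [← ha] at hf0
  have key : ∀ r : ℝ, 0 < r → ∃ x ∈ X, x ≠ 0 ∧ ‖x‖ ≠ r := by
    intro r hr
    by_contra! hcon
    -- With a single positive radius, ‖y‖² (‖y‖² - r²) would vanish on S, although it equals 12 r⁴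
    -- at norm 2r.
    have hz := h.eq_zero _ (radial_mem n 0 (-r ^ 2) 1) (by
      rintro y ⟨x, hx, hxy⟩
      rw [evalAt_radial, hxy]
      by_cases hx0 : x = 0
      · simp [hx0]
      · rw [hcon x hx hx0]; ring)
    have he := evalAt_radial 0 (-r ^ 2) 1
      (EuclideanSpace.single ⟨0, Nat.pos_of_ne_zero h.ne_zero⟩ (2 * r) : Rn n)
    rw [hz, evalAt, map_zero] at he
    have hnorm : ‖(EuclideanSpace.single ⟨0, Nat.pos_of_ne_zero h.ne_zero⟩ (2 * r) : Rn n)‖ = 2 * r := by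
      simp [abs_of_pos hr]
    rw [hnorm] at he
    have : 0 < r ^ 4 := by positivity
    nlinarith
  -- The radius 1 is arbitrary and only serves to produce a nonzero point.
  obtain ⟨x, hx, hx0, -⟩ := key 1 one_pos
  obtain ⟨y, hy, hy0, hxy⟩ := key ‖x‖ (norm_pos_iff.2 hx0)
  refine ⟨‖x‖, ‖y‖, norm_pos_iff.2 hx0, norm_pos_iff.2 hy0, hxy.symm, ⟨x, hx, rfl⟩, ⟨y, hy, rfl⟩, ?_⟩
  intro z hz hz0
  by_contra! hcon
  have px := norm_pos_iff.2 hx0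
  have py := norm_pos_iff.2 hy0
  have pz := norm_pos_iff.2 hz0
  have dxy : ‖x‖ ^ 2 - ‖y‖ ^ 2 ≠ 0 := by
    rw [sq_sub_sq]; exact mul_ne_zero (by positivity) (sub_ne_zero.2 hxy.symm)
  have dzx : ‖z‖ ^ 2 - ‖x‖ ^ 2 ≠ 0 := by
    rw [sq_sub_sq]; exact mul_ne_zero (by positivity) (sub_ne_zero.2 hcon.1)
  have dzy : ‖z‖ ^ 2 - ‖y‖ ^ 2 ≠ 0 := by
    rw [sq_sub_sq]; exact mul_ne_zero (by positivity) (sub_ne_zero.2 hcon.2)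
  have ex := hroot x hx hx0
  have ey := hroot y hy hy0
  have ez := hroot z hz hz0
  -- Divided differences: a quadratic in ‖·‖² with three distinct roots has all coefficients zero,
  -- contradicting a ≠ 0.
  have e1 : b + c * (‖x‖ ^ 2 + ‖y‖ ^ 2) = 0 := by
    apply mul_left_cancel₀ dxy; linear_combination ex - ey
  have e2 : b + c * (‖z‖ ^ 2 + ‖y‖ ^ 2) = 0 := by
    apply mul_left_cancel₀ dzy; linear_combination ez - ey
  have e3 : c = 0 := by
    apply mul_left_cancel₀ dzx; linear_combination e2 - e1
  rw [e3] at e1 ex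
  have e4 : b = 0 := by linarith
  rw [e4] at ex
  exact hf0 (by linarith)

end structural

/-! ### Functions on X \ {0} given by even quartics, and antipodality -/

section structural

variable {n : ℕ} {X : Finset (Rn n)} {w : Rn n → ℝ}

/-- `φ` agrees on `X \ {0}` with an even polynomial of degree at most four. -/
def IsQuartic (X : Finset (Rn n)) (φ : Rn n → ℝ) : Prop :=
  ∃ g ∈ boundPolys n 9, ∀ x ∈ X, x ≠ 0 → evalAt x g = φ x

lemma IsQuartic.add {φ ψ : Rn n → ℝ} (hφ : IsQuartic X φ) (hψ : IsQuartic X ψ) :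
    IsQuartic X fun x => φ x + ψ x := by
  obtain ⟨f, hf, hfX⟩ := hφ
  obtain ⟨g, hg, hgX⟩ := hψ
  refine ⟨f + g, Submodule.add_mem _ hf hg, fun x hx hx0 => ?_⟩
  dsimp only
  rw [← hfX x hx hx0, ← hgX x hx hx0]
  simp [evalAt]

lemma IsQuartic.const_mul {φ : Rn n → ℝ} (hφ : IsQuartic X φ) (c : ℝ) :
    IsQuartic X fun x => c * φ x := by
  obtain ⟨f, hf, hfX⟩ := hφ
  refine ⟨c • f, Submodule.smul_mem _ c hf, fun x hx hx0 => ?_⟩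
  dsimp only
  rw [← hfX x hx hx0]
  simp [evalAt]

lemma isQuartic_radial (a b c : ℝ) :
    IsQuartic X fun x => a + b * ‖x‖ ^ 2 + c * ‖x‖ ^ 4 :=
  ⟨radial n a b c, radial_mem n a b c, fun x _ _ => evalAt_radial a b c x⟩

lemma isQuartic_const (a : ℝ) : IsQuartic X fun _ => a := by
  simpa using isQuartic_radial (X := X) a 0 0

lemma IsQuartic.sum {ι : Type*} (s : Finset ι) {φ : ι → Rn n → ℝ}
    (h : ∀ i ∈ s, IsQuartic X (φ i)) : IsQuartic X fun x => ∑ i ∈ s, φ i x := by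
  classical
  induction s using Finset.induction_on with
  | empty => simpa using isQuartic_const (X := X) 0
  | insert i s hi ih =>
    simp only [Finset.sum_insert hi]
    exact (h i (Finset.mem_insert_self i s)).add
      (ih fun j hj => h j (Finset.mem_insert_of_mem hj))

lemma Tight.isQuartic_quotient (h : Tight X w) {l : Rn n}
    (hl : ∀ x ∈ X, x ≠ 0 → ⟪l, x⟫ ≠ 0) (a : Rn n) {φ : Rn n → ℝ} (hφ : IsQuartic X φ) :
    IsQuartic X fun x => ⟪a, x⟫ / ⟪l, x⟫ * φ x := by
  obtain ⟨f, hf, hfX⟩ := hφ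
  obtain ⟨g, hg, hgX⟩ := h.exists_quotient hl a hf
  exact ⟨g, hg, fun x hx hx0 => by rw [hgX x hx hx0, hfX x hx hx0]⟩

lemma ne_neg_of_ne_zero {x : Rn n} (hx : x ≠ 0) : x ≠ -x := by
  intro h
  have h2 : (2 : ℝ) • x = 0 := by
    rw [two_smul]
    nth_rewrite 2 [h]
    exact add_neg_cancel x
  exact hx ((smul_eq_zero.1 h2).resolve_left two_ne_zero)

/-- The component of `y` orthogonal to `x`. -/
noncomputable def perp (x y : Rn n) : Rn n := y - (⟪x, y⟫ / ‖x‖ ^ 2) • x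

lemma inner_perp_self {x : Rn n} (hx : x ≠ 0) (y : Rn n) : ⟪perp x y, x⟫ = 0 := by
  have : ‖x‖ ≠ 0 := norm_ne_zero_iff.2 hx
  rw [perp, inner_sub_left, real_inner_smul_left, real_inner_self_eq_norm_sq, real_inner_comm]
  field_simp
  ring

lemma inner_sq_of_inner_perp {x y : Rn n} (hx : x ≠ 0) (h : ⟪perp x y, y⟫ = 0) :
    ⟪x, y⟫ ^ 2 = ‖x‖ ^ 2 * ‖y‖ ^ 2 := by
  have h1 : ‖x‖ ≠ 0 := norm_ne_zero_iff.2 hx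
  rw [perp, inner_sub_left, real_inner_smul_left, real_inner_self_eq_norm_sq] at h
  field_simp at h
  linarith

lemma eq_or_eq_neg_of_inner_sq {x y : Rn n} (hxy : ‖x‖ = ‖y‖) (h : ⟪x, y⟫ ^ 2 = ‖x‖ ^ 2 * ‖y‖ ^ 2) :
    y = x ∨ y = -x := by
  have h1 : (⟪x, y⟫ - ‖x‖ ^ 2) * (⟪x, y⟫ + ‖x‖ ^ 2) = 0 := by
    rw [← hxy] at h; linear_combination h
  rcases mul_eq_zero.1 h1 with h2 | h2
  · left
    rw [← sub_eq_zero, ← norm_eq_zero, ← sq_eq_zero_iff, norm_sub_sq_real, real_inner_comm, ← hxy]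
    linarith
  · right
    rw [← sub_eq_zero, sub_neg_eq_add, ← norm_eq_zero, ← sq_eq_zero_iff, norm_add_sq_real,
      real_inner_comm, ← hxy]
    linarith

/-- An indicator of the line through `x`, among the points of `X \ {0}`, is an even quartic. -/
lemma Tight.exists_line_indicator (h : Tight X w) {x : Rn n} (hx0 : x ≠ 0) :
    ∃ φ : Rn n → ℝ, IsQuartic X φ ∧ φ x = 1 ∧ φ (-x) = 1 ∧
      ∀ y ∈ X, ⟪x, y⟫ ^ 2 ≠ ‖x‖ ^ 2 * ‖y‖ ^ 2 → φ y = 0 := by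
  classical
  obtain ⟨l, hl⟩ := exists_inner_ne_zero X
  -- As a sum of squares over all y in X, s vanishes at a nonzero point of X only if that point is
  -- orthogonal to its own component perpendicular to x, that is, lies on the line of x.
  set s : Rn n → ℝ := fun z => ∑ y ∈ X, (⟪perp x y, z⟫ / ⟪l, z⟫) ^ 2 with hs
  have hmul : ∀ φ : Rn n → ℝ, IsQuartic X φ → IsQuartic X fun z => s z * φ z := by
    intro φ hφ
    simp only [hs, Finset.sum_mul, sq, mul_assoc]
    exact IsQuartic.sum X fun y _ => h.isQuartic_quotient hl _ (h.isQuartic_quotient hl _ hφ)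
  -- Lagrange interpolation in the values of s. Closure under multiplication by s keeps products of
  -- any length among the quartics.
  have hprod : ∀ T : Finset (Rn n), IsQuartic X fun z => ∏ y ∈ T, (1 - s z / s y) := by
    intro T
    induction T using Finset.induction_on with
    | empty => simpa using isQuartic_const (X := X) 1
    | insert y T hy ih =>
      simp only [Finset.prod_insert hy]
      convert ih.add ((hmul _ ih).const_mul (-(s y)⁻¹)) using 2 with z
      rw [div_eq_mul_inv]
      ring
  have hsx : s x = 0 := by simp [hs, inner_perp_self hx0]
  have hsx' : s (-x) = 0 := by simp [hs, inner_perp_self hx0]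
  refine ⟨_, hprod (X.filter fun y => s y ≠ 0), by simp [hsx], by simp [hsx'], ?_⟩
  intro y hy hxy
  have hy0 : y ≠ 0 := by rintro rfl; simp at hxy
  have hsy : s y ≠ 0 := by
    intro h0
    rw [hs, Finset.sum_eq_zero_iff_of_nonneg fun _ _ => sq_nonneg _] at h0
    have := h0 y hy
    rw [sq_eq_zero_iff, div_eq_zero_iff, or_iff_left (hl y hy hy0)] at this
    exact hxy (inner_sq_of_inner_perp hx0 this)
  exact Finset.prod_eq_zero (Finset.mem_filter.2 ⟨hy, hsy⟩) (by rw [div_self hsy, sub_self])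

/-- A tight design is antipodal, with antipodal weights. -/
lemma Tight.antipodal (h : Tight X w) {x : Rn n} (hx : x ∈ X) : -x ∈ X ∧ w (-x) = w x := by
  classical
  by_cases hx0 : x = 0
  · simpa [hx0] using h.zero_mem
  obtain ⟨l, hl⟩ := exists_inner_ne_zero X
  obtain ⟨r₁, r₂, hr₁, hr₂, hne, -, -, hr⟩ := h.exists_radii
  obtain ⟨ρ, hρ0, hρx, hρ⟩ : ∃ ρ : ℝ, 0 < ρ ∧ ρ ≠ ‖x‖ ∧ ∀ y ∈ X, y ≠ 0 → ‖y‖ = ‖x‖ ∨ ‖y‖ = ρ := by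
    rcases hr x hx hx0 with h1 | h1
    · exact ⟨r₂, hr₂, by rw [h1]; exact hne.symm, by rw [h1]; exact hr⟩
    · exact ⟨r₁, hr₁, by rw [h1]; exact hne, by rw [h1]; exact fun y hy hy0 => (hr y hy hy0).symm⟩
  obtain ⟨φ, ⟨f, hf, hfX⟩, hφx, hφx', hφ⟩ := h.exists_line_indicator hx0
  -- The factor ‖y‖² - ρ² removes the other sphere and f removes the other lines, so only x and -x
  -- survive, with opposite signs of ⟪l, ·⟫.
  have hsum := h.sum_odd l hf (radial_mem n (-ρ ^ 2) 1 0)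
  simp only [evalAt_radial] at hsum
  have hzero : ∀ y ∈ X, y ≠ x → y ≠ -x →
      w y * (⟪l, y⟫ * evalAt y f * (-ρ ^ 2 + 1 * ‖y‖ ^ 2 + 0 * ‖y‖ ^ 4)) = 0 := by
    intro y hy h1 h2
    by_cases hy0 : y = 0
    · simp [hy0]
    rcases hρ y hy hy0 with h3 | h3
    · have : ⟪x, y⟫ ^ 2 ≠ ‖x‖ ^ 2 * ‖y‖ ^ 2 := fun h4 =>
        (eq_or_eq_neg_of_inner_sq h3.symm h4).elim h1 h2
      rw [hfX y hy hy0, hφ y hy this]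
      simp
    · rw [h3]; ring
  have hd : -ρ ^ 2 + 1 * ‖x‖ ^ 2 + 0 * ‖x‖ ^ 4 ≠ 0 := by
    have h1 : (‖x‖ - ρ) * (‖x‖ + ρ) ≠ 0 :=
      mul_ne_zero (sub_ne_zero.2 hρx.symm) (by positivity)
    intro h2
    exact h1 (by linear_combination h2)
  have hlx := hl x hx hx0
  have hwx := h.design.weight_pos hx
  have hxx := ne_neg_of_ne_zero hx0
  rw [← Finset.add_sum_erase _ _ hx] at hsum
  by_cases hmem : -x ∈ X
  · refine ⟨hmem, ?_⟩
    rw [← Finset.add_sum_erase _ _ (Finset.mem_erase.2 ⟨hxx.symm, hmem⟩), Finset.sum_eq_zero,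
      hfX x hx hx0, hfX (-x) hmem (neg_ne_zero.2 hx0), hφx, hφx', norm_neg, inner_neg_right] at hsum
    · apply mul_right_cancel₀ (mul_ne_zero hlx hd)
      linear_combination -hsum
    · intro y hy
      simp only [Finset.mem_erase] at hy
      exact hzero y hy.2.2 hy.2.1 hy.1
  · exfalso
    rw [Finset.sum_eq_zero, hfX x hx hx0, hφx] at hsum
    · have : w x * (⟪l, x⟫ * (-ρ ^ 2 + 1 * ‖x‖ ^ 2 + 0 * ‖x‖ ^ 4)) = 0 := by linear_combination hsum
      exact mul_ne_zero hwx.ne' (mul_ne_zero hlx hd) this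
    · intro y hy
      simp only [Finset.mem_erase] at hy
      exact hzero y hy.2 hy.1 (fun h1 => hmem (h1 ▸ hy.2))

end structural

/-! ### The two shells and their moments -/

section shells

variable {n : ℕ} {X : Finset (Rn n)} {w : Rn n → ℝ} {r ρ : ℝ}

/-- The points of `X` of norm `r`. -/
noncomputable def shell (X : Finset (Rn n)) (r : ℝ) : Finset (Rn n) := X.filter fun x => ‖x‖ = r

/-- The total weight of the points of norm `r`. -/
noncomputable def mass (X : Finset (Rn n)) (w : Rn n → ℝ) (r : ℝ) : ℝ := ∑ x ∈ shell X r, w x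

lemma mem_shell {x : Rn n} : x ∈ shell X r ↔ x ∈ X ∧ ‖x‖ = r := Finset.mem_filter

/-- A tight design whose nonzero points lie on the spheres of radius `r` and `ρ`. -/
structure Shells (X : Finset (Rn n)) (w : Rn n → ℝ) (r ρ : ℝ) : Prop where
  tight : Tight X w
  left_pos : 0 < r
  right_pos : 0 < ρ
  ne : r ≠ ρ
  left_nonempty : (shell X r).Nonempty
  right_nonempty : (shell X ρ).Nonempty
  cover : ∀ x ∈ X, x ≠ 0 → ‖x‖ = r ∨ ‖x‖ = ρ

lemma Tight.exists_shells (h : Tight X w) : ∃ r ρ : ℝ, Shells X w r ρ := by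
  obtain ⟨r, ρ, hr, hρ, hne, ⟨x, hx⟩, ⟨y, hy⟩, hc⟩ := h.exists_radii
  exact ⟨r, ρ, h, hr, hρ, hne, ⟨x, mem_shell.2 hx⟩, ⟨y, mem_shell.2 hy⟩, hc⟩

lemma Shells.symm (h : Shells X w r ρ) : Shells X w ρ r :=
  ⟨h.tight, h.right_pos, h.left_pos, h.ne.symm, h.right_nonempty, h.left_nonempty,
    fun x hx hx0 => (h.cover x hx hx0).symm⟩

lemma Shells.sum_eq (h : Shells X w r ρ) (F : Rn n → ℝ) :
    ∑ x ∈ X, F x = F 0 + ∑ x ∈ shell X r, F x + ∑ x ∈ shell X ρ, F x := by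
  classical
  rw [← Finset.add_sum_erase _ _ h.tight.zero_mem, add_assoc]
  congr 1
  rw [← Finset.sum_union]
  · refine Finset.sum_congr ?_ fun _ _ => rfl
    ext x
    simp only [Finset.mem_erase, Finset.mem_union, mem_shell]
    constructor
    · rintro ⟨hx0, hx⟩
      exact (h.cover x hx hx0).imp (fun hh => ⟨hx, hh⟩) (fun hh => ⟨hx, hh⟩)
    · rintro (⟨hx, hh⟩ | ⟨hx, hh⟩)
      · exact ⟨fun h0 => h.left_pos.ne' (by rw [← hh, h0, norm_zero]), hx⟩
      · exact ⟨fun h0 => h.right_pos.ne' (by rw [← hh, h0, norm_zero]), hx⟩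
  · rw [Finset.disjoint_left]
    intro x hx hx'
    exact h.ne ((mem_shell.1 hx).2.symm.trans (mem_shell.1 hx').2)

lemma Shells.card_eq (h : Shells X w r ρ) :
    (X.card : ℝ) = 1 + (shell X r).card + (shell X ρ).card := by
  have := h.sum_eq fun _ => (1 : ℝ)
  simpa using this

lemma Shells.weight_pos (h : Shells X w r ρ) {s : ℝ} {x : Rn n} (hx : x ∈ shell X s) : 0 < w x :=
  h.tight.design.weight_pos (mem_shell.1 hx).1

lemma Shells.mass_pos (h : Shells X w r ρ) : 0 < mass X w r :=
  Finset.sum_pos (fun _ hx => h.weight_pos hx) h.left_nonempty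

lemma Shells.neg_mem (h : Shells X w r ρ) {s : ℝ} {x : Rn n} (hx : x ∈ shell X s) :
    -x ∈ shell X s := by
  rw [mem_shell] at hx ⊢
  exact ⟨(h.tight.antipodal hx.1).1, by rw [norm_neg, hx.2]⟩

lemma Shells.ne_zero (h : Shells X w r ρ) {x : Rn n} (hx : x ∈ shell X r) : x ≠ 0 := by
  rintro rfl
  exact h.left_pos.ne' (by rw [← (mem_shell.1 hx).2, norm_zero])

/-- Each shell has the moments of a spherical `7`-design. -/
lemma Shells.sum_inner_pow (h : Shells X w r ρ) (a : Rn n) {k : ℕ} (hk : k ≤ 3) :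
    ∑ x ∈ shell X r, w x * (⟪a, x⟫ ^ (2 * k) - moment n k * ‖a‖ ^ (2 * k) * r ^ (2 * k)) = 0 := by
  -- For k = 0 every summand is zero. For k > 0 the origin drops out because `0 ^ (2 * k) = 0`.
  rcases Nat.eq_zero_or_pos k with rfl | hk0
  · simp [moment]
  -- The extra factor ‖x‖² in `h1` weights the two spheres differently, so the shell of radius ρ can
  -- be eliminated. This needs 2k + 2 ≤ 9, whence k ≤ 3.
  have h0 := h.tight.design.sum_inner_pow h.tight.ne_zero a (k := k) (j := 0) (by omega)
  have h1 := h.tight.design.sum_inner_pow h.tight.ne_zero a (k := k) (j := 1) (by omega)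
  rw [h.sum_eq] at h0 h1
  rw [Finset.sum_congr rfl fun x hx => by rw [(mem_shell.1 hx).2],
    Finset.sum_congr (s₁ := shell X ρ) rfl fun x hx => by rw [(mem_shell.1 hx).2]] at h0 h1
  simp only [mul_zero, pow_zero, mul_one, ← mul_assoc, inner_zero_right, norm_zero] at h0 h1
  rw [← Finset.sum_mul, ← Finset.sum_mul] at h1
  have hz : (0 : ℝ) ^ (2 * k) = 0 := zero_pow (by omega)
  rw [hz] at h0 h1
  have hne : r ^ 2 - ρ ^ 2 ≠ 0 := by
    have := h.left_pos
    have := h.right_pos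
    rw [sq_sub_sq]
    exact mul_ne_zero (by positivity) (sub_ne_zero.2 h.ne)
  apply mul_left_cancel₀ hne
  simp only [mul_assoc] at h0 h1 ⊢
  linear_combination h1 - ρ ^ 2 * h0

/-- The eighth moments of the two shells balance. -/
lemma Shells.sum_inner_pow_eight (h : Shells X w r ρ) (a : Rn n) :
    ∑ x ∈ shell X r, w x * (⟪a, x⟫ ^ 8 - moment n 4 * ‖a‖ ^ 8 * r ^ 8) +
    ∑ x ∈ shell X ρ, w x * (⟪a, x⟫ ^ 8 - moment n 4 * ‖a‖ ^ 8 * ρ ^ 8) = 0 := by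
  have h0 := h.tight.design.sum_inner_pow h.tight.ne_zero a (k := 4) (j := 0) (by omega)
  rw [h.sum_eq] at h0
  rw [Finset.sum_congr rfl fun x hx => by rw [(mem_shell.1 hx).2],
    Finset.sum_congr (s₁ := shell X ρ) rfl fun x hx => by rw [(mem_shell.1 hx).2]] at h0
  simpa using h0

/-- The squared cosine of the angle between two vectors. -/
noncomputable def cosSq (x y : Rn n) : ℝ := (⟪x, y⟫ / (‖x‖ * ‖y‖)) ^ 2

lemma cosSq_pow (x y : Rn n) (k : ℕ) :
    cosSq x y ^ k = ⟪x, y⟫ ^ (2 * k) / (‖x‖ ^ (2 * k) * ‖y‖ ^ (2 * k)) := by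
  rw [cosSq, ← pow_mul, div_pow, mul_pow]

lemma Shells.sum_cosSq_pow (h : Shells X w r ρ) {a : Rn n} (ha : a ≠ 0) {k : ℕ} (hk : k ≤ 3) :
    ∑ x ∈ shell X r, w x * cosSq a x ^ k = mass X w r * moment n k := by
  have h1 := h.sum_inner_pow a hk
  have hr := h.left_pos
  have ha' := norm_pos_iff.2 ha
  rw [mass, Finset.sum_mul, ← sub_eq_zero, ← Finset.sum_sub_distrib]
  have hc : ‖a‖ ^ (2 * k) * r ^ (2 * k) ≠ 0 := by positivity
  apply mul_left_cancel₀ hc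
  rw [mul_zero, ← h1, Finset.mul_sum]
  refine Finset.sum_congr rfl fun x hx => ?_
  rw [cosSq_pow, (mem_shell.1 hx).2]
  field_simp

lemma Shells.sum_cosSq_pow_four (h : Shells X w r ρ) {a : Rn n} (ha : a ≠ 0) :
    r ^ 8 * ∑ x ∈ shell X r, w x * cosSq a x ^ 4 + ρ ^ 8 * ∑ x ∈ shell X ρ, w x * cosSq a x ^ 4 =
      (mass X w r * r ^ 8 + mass X w ρ * ρ ^ 8) * moment n 4 := by
  have h1 := h.sum_inner_pow_eight a
  have hr := h.left_pos
  have hρ := h.right_pos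
  have ha' := norm_pos_iff.2 ha
  have hc : ‖a‖ ^ 8 ≠ 0 := by positivity
  have e : ∀ s : ℝ, 0 < s → ‖a‖ ^ 8 * (s ^ 8 * ∑ x ∈ shell X s, w x * cosSq a x ^ 4) =
      ∑ x ∈ shell X s, w x * ⟪a, x⟫ ^ 8 := by
    intro s hs
    rw [Finset.mul_sum, Finset.mul_sum]
    refine Finset.sum_congr rfl fun x hx => ?_
    rw [cosSq_pow, (mem_shell.1 hx).2]
    field_simp
    ring
  simp only [mul_sub, Finset.sum_sub_distrib, ← Finset.sum_mul] at h1
  apply mul_left_cancel₀ hc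
  rw [mul_add, e r hr, e ρ hρ]
  simp only [mass]
  linear_combination h1

end shells

/-! ### Zonal kernels, the reproducing identity and its equality case -/

/-- The zonal kernel of harmonic polynomials of degree four, in terms of the squared cosine. -/
noncomputable def zonal₄ (n : ℕ) (u : ℝ) : ℝ :=
  n * (n + 2) * (n + 4) * (n + 6) / 24 * u ^ 2 - n * (n + 2) * (n + 6) / 4 * u + n * (n + 6) / 8

/-- The zonal kernel of harmonic polynomials of degrees zero and two, in terms of the squared
cosine. -/
noncomputable def zonal₂ (n : ℕ) (u : ℝ) : ℝ := n / 2 * ((n + 2) * u - 1)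

lemma moment_zero (n : ℕ) : moment n 0 = 1 := rfl

lemma moment_one (n : ℕ) : moment n 1 = 1 / n := by simp [moment]

lemma moment_two (n : ℕ) : moment n 2 = 3 / (n * (n + 2)) := by
  rw [moment, moment_one, div_mul_eq_mul_div, div_div]; norm_num

lemma moment_three (n : ℕ) : moment n 3 = 15 / (n * (n + 2) * (n + 4)) := by
  rw [moment, moment_two, div_mul_eq_mul_div, div_div]; norm_num

lemma moment_four (n : ℕ) : moment n 4 = 105 / (n * (n + 2) * (n + 4) * (n + 6)) := by
  rw [moment, moment_three, div_mul_eq_mul_div, div_div]; norm_num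

lemma sum_mul_quartic {ι : Type*} (s : Finset ι) (w u : ι → ℝ) (a b c d e : ℝ) :
    ∑ i ∈ s, w i * (a * u i ^ 4 + b * u i ^ 3 + c * u i ^ 2 + d * u i + e) =
      a * ∑ i ∈ s, w i * u i ^ 4 + b * ∑ i ∈ s, w i * u i ^ 3 + c * ∑ i ∈ s, w i * u i ^ 2 +
        d * ∑ i ∈ s, w i * u i ^ 1 + e * ∑ i ∈ s, w i * u i ^ 0 := by
  simp only [Finset.mul_sum, ← Finset.sum_add_distrib]
  refine Finset.sum_congr rfl fun i _ => ?_
  ring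

section shells

variable {n : ℕ} {X : Finset (Rn n)} {w : Rn n → ℝ} {r ρ : ℝ}

/-- The total mass of the eighth power of the norm. -/
noncomputable def mass₈ (X : Finset (Rn n)) (w : Rn n → ℝ) (r ρ : ℝ) : ℝ :=
  mass X w r * r ^ 8 + mass X w ρ * ρ ^ 8

/-- The share of the sphere of radius `r` in the eighth moment. -/
noncomputable def share (X : Finset (Rn n)) (w : Rn n → ℝ) (r ρ : ℝ) : ℝ :=
  mass X w r * r ^ 8 / mass₈ X w r ρ

lemma mass₈_comm (X : Finset (Rn n)) (w : Rn n → ℝ) (r ρ : ℝ) : mass₈ X w r ρ = mass₈ X w ρ r :=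
  add_comm _ _

lemma Shells.mass₈_pos (h : Shells X w r ρ) : 0 < mass₈ X w r ρ := by
  have := h.mass_pos
  have := h.symm.mass_pos
  have := h.left_pos
  have := h.right_pos
  unfold mass₈
  positivity

lemma Shells.share_pos (h : Shells X w r ρ) : 0 < share X w r ρ :=
  div_pos (mul_pos h.mass_pos (pow_pos h.left_pos 8)) h.mass₈_pos

lemma Shells.share_add (h : Shells X w r ρ) : share X w r ρ + share X w ρ r = 1 := by
  rw [share, share, mass₈_comm X w ρ r, ← add_div]
  exact div_self (ne_of_gt h.mass₈_pos)

/-- The value of the reproducing kernel on the diagonal, times the mass of the sphere. -/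
noncomputable def diag (X : Finset (Rn n)) (w : Rn n → ℝ) (r ρ : ℝ) : ℝ :=
  share X w r ρ * zonal₄ n 1 + zonal₂ n 1

lemma Shells.cast_pos (h : Shells X w r ρ) : (0 : ℝ) < n :=
  Nat.cast_pos.2 (Nat.pos_of_ne_zero h.tight.ne_zero)

/-- The reproducing property in degrees 0 and 2. Only moments of degree at most 4 occur, so it holds
on a single shell. -/
lemma Shells.sum_zonal₂_sq (h : Shells X w r ρ) {a : Rn n} (ha : a ≠ 0) :
    ∑ z ∈ shell X r, w z * zonal₂ n (cosSq a z) ^ 2 = mass X w r * zonal₂ n 1 := by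
  have hn := h.cast_pos
  have e := sum_mul_quartic (shell X r) w (cosSq a) 0 0 (n ^ 2 / 4 * (n + 2) ^ 2)
    (-n ^ 2 / 2 * (n + 2)) (n ^ 2 / 4)
  rw [h.sum_cosSq_pow ha (k := 0) (by norm_num), h.sum_cosSq_pow ha (k := 1) (by norm_num),
    h.sum_cosSq_pow ha (k := 2) (by norm_num), moment_zero, moment_one, moment_two] at e
  have e2 : ∑ z ∈ shell X r, w z * zonal₂ n (cosSq a z) ^ 2 = _ :=
    (Finset.sum_congr rfl fun z _ => by rw [zonal₂]; ring).trans e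
  rw [e2, zonal₂]
  field_simp
  ring

/-- Harmonics of degree 4 are orthogonal to those of degrees 0 and 2. The product has degree 6,
still within reach of a single shell. -/
lemma Shells.sum_zonal₄_mul_zonal₂ (h : Shells X w r ρ) {a : Rn n} (ha : a ≠ 0) :
    ∑ z ∈ shell X r, w z * (zonal₄ n (cosSq a z) * zonal₂ n (cosSq a z)) = 0 := by
  have hn := h.cast_pos
  have e := sum_mul_quartic (shell X r) w (cosSq a) 0
    (n * (n + 2) * (n + 4) * (n + 6) / 24 * (n / 2 * (n + 2)))
    (-(n * (n + 2) * (n + 6) / 4) * (n / 2 * (n + 2)) -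
      n * (n + 2) * (n + 4) * (n + 6) / 24 * (n / 2))
    (n * (n + 6) / 8 * (n / 2 * (n + 2)) + n * (n + 2) * (n + 6) / 4 * (n / 2))
    (-(n * (n + 6) / 8) * (n / 2))
  rw [h.sum_cosSq_pow ha (k := 0) (by norm_num), h.sum_cosSq_pow ha (k := 1) (by norm_num),
    h.sum_cosSq_pow ha (k := 2) (by norm_num), h.sum_cosSq_pow ha (k := 3) (by norm_num),
    moment_zero, moment_one, moment_two, moment_three] at e
  have e2 : ∑ z ∈ shell X r, w z * (zonal₄ n (cosSq a z) * zonal₂ n (cosSq a z)) = _ :=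
    (Finset.sum_congr rfl fun z _ => by rw [zonal₂, zonal₄]; ring).trans e
  rw [e2]
  field_simp
  ring

/-- Here degree 8 enters, so only the combination of both shells weighted by the eighth powers of
the radii is available. The lower moments match on each shell. -/
lemma Shells.sum_zonal₄_sq (h : Shells X w r ρ) {a : Rn n} (ha : a ≠ 0) :
    r ^ 8 * ∑ z ∈ shell X r, w z * zonal₄ n (cosSq a z) ^ 2 +
      ρ ^ 8 * ∑ z ∈ shell X ρ, w z * zonal₄ n (cosSq a z) ^ 2 = mass₈ X w r ρ * zonal₄ n 1 := by
  have hn := h.cast_pos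
  set A : ℝ := n * (n + 2) * (n + 4) * (n + 6) / 24 with hA
  set B : ℝ := n * (n + 2) * (n + 6) / 4 with hB
  set C : ℝ := n * (n + 6) / 8 with hC
  have e : ∀ s : ℝ, ∑ z ∈ shell X s, w z * zonal₄ n (cosSq a z) ^ 2 = _ := fun s =>
    (Finset.sum_congr rfl fun z _ => by rw [zonal₄]; ring).trans
      (sum_mul_quartic (shell X s) w (cosSq a) (A ^ 2) (-2 * A * B) (B ^ 2 + 2 * A * C)
        (-2 * B * C) (C ^ 2))
  have h4 := h.sum_cosSq_pow_four ha
  rw [← mass₈] at h4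
  rw [e r, e ρ]
  have h3 := h.sum_cosSq_pow ha (k := 3) (by norm_num)
  have h2 := h.sum_cosSq_pow ha (k := 2) (by norm_num)
  have h1 := h.sum_cosSq_pow ha (k := 1) (by norm_num)
  have h0 := h.sum_cosSq_pow ha (k := 0) (by norm_num)
  have h3' := h.symm.sum_cosSq_pow ha (k := 3) (by norm_num)
  have h2' := h.symm.sum_cosSq_pow ha (k := 2) (by norm_num)
  have h1' := h.symm.sum_cosSq_pow ha (k := 1) (by norm_num)
  have h0' := h.symm.sum_cosSq_pow ha (k := 0) (by norm_num)
  rw [h3, h2, h1, h0, h3', h2', h1', h0']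
  have hz : zonal₄ n 1 = A ^ 2 * moment n 4 + -2 * A * B * moment n 3 +
      (B ^ 2 + 2 * A * C) * moment n 2 + -2 * B * C * moment n 1 + C ^ 2 * moment n 0 := by
    rw [moment_zero, moment_one, moment_two, moment_three, moment_four, zonal₄, hA, hB, hC]
    field_simp
    ring
  rw [hz]
  simp only [mass₈] at h4 ⊢
  linear_combination A ^ 2 * h4

/-- The reproducing property of the kernel at a point of `X`. -/
lemma Shells.sum_kernel_sq (h : Shells X w r ρ) {x : Rn n} (hx : x ∈ shell X r) :
    ∑ z ∈ shell X r, w z * (share X w r ρ * zonal₄ n (cosSq x z) + zonal₂ n (cosSq x z)) ^ 2 +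
      share X w r ρ ^ 2 * (ρ ^ 8 / r ^ 8) * ∑ z ∈ shell X ρ, w z * zonal₄ n (cosSq x z) ^ 2 =
      mass X w r * diag X w r ρ := by
  have hx0 := h.ne_zero hx
  have h1 := h.sum_zonal₂_sq hx0
  have h2 := h.sum_zonal₄_mul_zonal₂ hx0
  have h3 := h.sum_zonal₄_sq hx0
  have hr := h.left_pos
  have hQ := h.mass₈_pos
  have e : ∑ z ∈ shell X r, w z * (share X w r ρ * zonal₄ n (cosSq x z) + zonal₂ n (cosSq x z)) ^ 2
      = share X w r ρ ^ 2 * ∑ z ∈ shell X r, w z * zonal₄ n (cosSq x z) ^ 2 +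
        2 * share X w r ρ * ∑ z ∈ shell X r, w z * (zonal₄ n (cosSq x z) * zonal₂ n (cosSq x z)) +
        ∑ z ∈ shell X r, w z * zonal₂ n (cosSq x z) ^ 2 := by
    simp only [Finset.mul_sum, ← Finset.sum_add_distrib]
    refine Finset.sum_congr rfl fun i _ => ?_
    ring
  rw [e, h2, h1, diag]
  have hs : share X w r ρ * mass₈ X w r ρ = mass X w r * r ^ 8 := by
    rw [share]; field_simp
  generalize share X w r ρ = s at *
  generalize ∑ z ∈ shell X r, w z * zonal₄ n (cosSq x z) ^ 2 = S₁ at *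
  generalize ∑ z ∈ shell X ρ, w z * zonal₄ n (cosSq x z) ^ 2 = S₂ at *
  field_simp
  linear_combination s ^ 2 * h3 + s * zonal₄ n 1 * hs

lemma cosSq_self {x : Rn n} (hx : x ≠ 0) : cosSq x x = 1 := by
  have := norm_ne_zero_iff.2 hx
  rw [cosSq, real_inner_self_eq_norm_sq]
  field_simp

lemma cosSq_neg_right (x y : Rn n) : cosSq x (-y) = cosSq x y := by
  rw [cosSq, cosSq, inner_neg_right, norm_neg, neg_div, neg_sq]

lemma Shells.zonal₂_one_pos (h : Shells X w r ρ) : 0 < zonal₂ n 1 := by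
  have := h.cast_pos
  have e : zonal₂ n 1 = n * (n + 1) / 2 := by rw [zonal₂]; ring
  rw [e]
  positivity

/-- The value is the dimension of the space of harmonic polynomials of degree four, which is zero
for n = 1. -/
lemma Shells.zonal₄_one_nonneg (h : Shells X w r ρ) : 0 ≤ zonal₄ n 1 := by
  have h1 : (1 : ℝ) ≤ n := Nat.one_le_cast.2 (Nat.pos_of_ne_zero h.tight.ne_zero)
  have e : zonal₄ n 1 = n * (n + 6) * (n + 1) * (n - 1) / 24 := by rw [zonal₄]; ring
  rw [e]
  have : (0 : ℝ) ≤ n - 1 := by linarith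
  positivity

lemma Shells.diag_pos (h : Shells X w r ρ) : 0 < diag X w r ρ :=
  add_pos_of_nonneg_of_pos (mul_nonneg h.share_pos.le h.zonal₄_one_nonneg) h.zonal₂_one_pos

/-- Splitting off the two antipodal points in the reproducing property. -/
lemma Shells.sum_kernel_sq_erase (h : Shells X w r ρ) {x : Rn n} (hx : x ∈ shell X r) :
    2 * w x * diag X w r ρ ^ 2 +
    (∑ z ∈ ((shell X r).erase x).erase (-x),
      w z * (share X w r ρ * zonal₄ n (cosSq x z) + zonal₂ n (cosSq x z)) ^ 2 +
      share X w r ρ ^ 2 * (ρ ^ 8 / r ^ 8) * ∑ z ∈ shell X ρ, w z * zonal₄ n (cosSq x z) ^ 2) =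
      mass X w r * diag X w r ρ := by
  have hx0 := h.ne_zero hx
  have h1 := h.sum_kernel_sq hx
  rw [← Finset.add_sum_erase _ _ hx, ← Finset.add_sum_erase _ _
    (Finset.mem_erase.2 ⟨(ne_neg_of_ne_zero hx0).symm, h.neg_mem hx⟩), cosSq_neg_right,
    cosSq_self hx0, (h.tight.antipodal (mem_shell.1 hx).1).2, ← diag] at h1
  linear_combination h1

/-- In `Shells.sum_kernel_sq_erase` everything beyond the terms at x and -x is nonnegative. -/
lemma Shells.two_mul_weight_le (h : Shells X w r ρ) {x : Rn n} (hx : x ∈ shell X r) :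
    2 * w x * diag X w r ρ ≤ mass X w r := by
  have h1 := h.sum_kernel_sq_erase hx
  have hr := h.left_pos
  have h2 : 0 ≤ ∑ z ∈ ((shell X r).erase x).erase (-x),
      w z * (share X w r ρ * zonal₄ n (cosSq x z) + zonal₂ n (cosSq x z)) ^ 2 :=
    Finset.sum_nonneg fun z hz => mul_nonneg
      (h.weight_pos (Finset.mem_of_mem_erase (Finset.mem_of_mem_erase hz))).le (sq_nonneg _)
  have h3 : 0 ≤ ∑ z ∈ shell X ρ, w z * zonal₄ n (cosSq x z) ^ 2 :=
    Finset.sum_nonneg fun z hz => mul_nonneg (h.weight_pos hz).le (sq_nonneg _)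
  have h4 : 0 ≤ share X w r ρ ^ 2 * (ρ ^ 8 / r ^ 8) :=
    mul_nonneg (sq_nonneg _) (div_nonneg (pow_nonneg h.right_pos.le 8) (pow_nonneg hr.le 8))
  have h5 := mul_nonneg h4 h3
  have hd := h.diag_pos
  apply le_of_mul_le_mul_right _ hd
  nlinarith

lemma Shells.two_mul_diag_le_card (h : Shells X w r ρ) :
    2 * diag X w r ρ ≤ (shell X r).card := by
  have h1 := Finset.sum_le_sum fun x hx => h.two_mul_weight_le hx
  rw [← Finset.sum_mul, ← Finset.mul_sum, ← mass, Finset.sum_const, nsmul_eq_mul] at h1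
  have := h.mass_pos
  apply le_of_mul_le_mul_right _ this
  linarith

/-- The size of each shell. -/
lemma Shells.card_shell (h : Shells X w r ρ) : ((shell X r).card : ℝ) = 2 * diag X w r ρ := by
  have h1 := h.two_mul_diag_le_card
  have h2 := h.symm.two_mul_diag_le_card
  have h3 := h.card_eq
  rw [h.tight.card_eq, Nat.cast_sub (by have := h.tight.one_le_finrank; omega)] at h3
  have h4 := finrank_boundPolys_le n
  -- The diagonals sum to the bound of `finrank_boundPolys_le` minus 1. Hence |X| - 1 is at most
  -- twice that sum, and the two lower bounds for the shells are attained.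
  have h5 : diag X w r ρ + diag X w ρ r =
      n * (n + 1) * (n + 2) * (n + 3) / 24 + n * (n + 1) / 2 := by
    have hs := h.share_add
    rw [diag, diag, zonal₄, zonal₂]
    linear_combination (n * (n + 2) * (n + 4) * (n + 6) / 24 * 1 ^ 2 -
      n * (n + 2) * (n + 6) / 4 * 1 + n * (n + 6) / 8 : ℝ) * hs
  push_cast at h3
  linarith

lemma Shells.two_mul_weight (h : Shells X w r ρ) {x : Rn n} (hx : x ∈ shell X r) :
    2 * w x * diag X w r ρ = mass X w r := by
  have h1 : ∑ x ∈ shell X r, 2 * w x * diag X w r ρ = ∑ x ∈ shell X r, mass X w r := by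
    rw [← Finset.sum_mul, ← Finset.mul_sum, ← mass, Finset.sum_const, nsmul_eq_mul, h.card_shell]
    ring
  exact (Finset.sum_eq_sum_iff_of_le fun x hx => h.two_mul_weight_le hx).1 h1 x hx

/-- With equality in `Shells.two_mul_weight_le`, the discarded nonnegative terms are all zero. -/
lemma Shells.kernel_eq_zero (h : Shells X w r ρ) {x : Rn n} (hx : x ∈ shell X r) :
    (∀ z ∈ shell X r, z ≠ x → z ≠ -x →
      share X w r ρ * zonal₄ n (cosSq x z) + zonal₂ n (cosSq x z) = 0) ∧
    ∀ z ∈ shell X ρ, zonal₄ n (cosSq x z) = 0 := by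
  have h1 := h.sum_kernel_sq_erase hx
  have hr := h.left_pos
  have hρ := h.right_pos
  have hs := h.share_pos
  have p2 : ∀ z ∈ ((shell X r).erase x).erase (-x),
      0 ≤ w z * (share X w r ρ * zonal₄ n (cosSq x z) + zonal₂ n (cosSq x z)) ^ 2 :=
    fun z hz => mul_nonneg
      (h.weight_pos (Finset.mem_of_mem_erase (Finset.mem_of_mem_erase hz))).le (sq_nonneg _)
  have p3 : ∀ z ∈ shell X ρ, 0 ≤ w z * zonal₄ n (cosSq x z) ^ 2 :=
    fun z hz => mul_nonneg (h.weight_pos hz).le (sq_nonneg _)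
  have h2 := Finset.sum_nonneg p2
  have h3 := Finset.sum_nonneg p3
  have h4 : 0 < share X w r ρ ^ 2 * (ρ ^ 8 / r ^ 8) := by positivity
  have h5 := mul_nonneg h4.le h3
  have h6 : 2 * w x * diag X w r ρ ^ 2 = mass X w r * diag X w r ρ := by
    rw [← h.two_mul_weight hx]; ring
  have z2 := (Finset.sum_eq_zero_iff_of_nonneg p2).1 (by linarith)
  have z3 := (Finset.sum_eq_zero_iff_of_nonneg p3).1
    ((mul_eq_zero.1 (show share X w r ρ ^ 2 * (ρ ^ 8 / r ^ 8) * _ = 0 by linarith)).resolve_left h4.ne')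
  constructor
  · intro z hz hzx hzx'
    have := z2 z (Finset.mem_erase.2 ⟨hzx', Finset.mem_erase.2 ⟨hzx, hz⟩⟩)
    rwa [mul_eq_zero, or_iff_right (h.weight_pos hz).ne', sq_eq_zero_iff] at this
  · intro z hz
    have := z3 z hz
    rwa [mul_eq_zero, or_iff_right (h.weight_pos hz).ne', sq_eq_zero_iff] at this

/-- The unweighted moments of a shell. -/
lemma Shells.sum_cosSq (h : Shells X w r ρ) {a : Rn n} (ha : a ≠ 0) {k : ℕ} (hk : k ≤ 3) :
    ∑ x ∈ shell X r, cosSq a x ^ k = (shell X r).card * moment n k := by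
  have h1 := h.sum_cosSq_pow ha hk
  have hd := h.diag_pos
  have hm := h.mass_pos
  apply mul_left_cancel₀ hm.ne'
  rw [h.card_shell, ← mul_assoc, mul_right_comm, ← h1, Finset.mul_sum, Finset.sum_mul]
  refine Finset.sum_congr rfl fun x hx => ?_
  rw [← h.two_mul_weight hx]
  ring

end shells

/-! ### Representatives of antipodal pairs, and the number of spheres -/

section shells

variable {n : ℕ} {X : Finset (Rn n)} {w : Rn n → ℝ} {r ρ : ℝ}

/-- One point out of each antipodal pair of a shell, chosen by a linear form. -/
noncomputable def halfShell (X : Finset (Rn n)) (l : Rn n) (r : ℝ) : Finset (Rn n) :=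
  (shell X r).filter fun x => 0 < ⟪l, x⟫

lemma Shells.card_shell_eq (h : Shells X w r ρ) {l : Rn n} (hl : ∀ x ∈ X, x ≠ 0 → ⟪l, x⟫ ≠ 0) :
    (shell X r).card = 2 * (halfShell X l r).card := by
  rw [← Finset.card_filter_add_card_filter_not (s := shell X r) (fun x => 0 < ⟪l, x⟫), two_mul,
    halfShell]
  congr 1
  refine Finset.card_bij (fun x _ => -x) ?_ (fun x _ y _ hxy => neg_injective hxy) ?_
  · intro x hx
    rw [Finset.mem_filter] at hx ⊢
    refine ⟨h.neg_mem hx.1, ?_⟩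
    rw [inner_neg_right, Left.neg_pos_iff]
    exact lt_of_le_of_ne (not_lt.1 hx.2) (hl x (mem_shell.1 hx.1).1 (h.ne_zero hx.1))
  · intro x hx
    rw [Finset.mem_filter] at hx
    refine ⟨-x, Finset.mem_filter.2 ⟨h.neg_mem hx.1, ?_⟩, neg_neg x⟩
    rw [inner_neg_right, not_lt, Left.neg_nonpos_iff]
    exact hx.2.le

lemma Shells.numSpheres_eq (h : Shells X w r ρ) : numSpheres X = 3 := by
  classical
  have e : (X.image fun x => ‖x‖) = {0, r, ρ} := by
    ext s
    simp only [Finset.mem_image, Finset.mem_insert, Finset.mem_singleton]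
    constructor
    · rintro ⟨x, hx, rfl⟩
      by_cases hx0 : x = 0
      · left; rw [hx0, norm_zero]
      · right; exact h.cover x hx hx0
    · rintro (rfl | rfl | rfl)
      · exact ⟨0, h.tight.zero_mem, norm_zero⟩
      · obtain ⟨x, hx⟩ := h.left_nonempty
        exact ⟨x, mem_shell.1 hx⟩
      · obtain ⟨x, hx⟩ := h.right_nonempty
        exact ⟨x, mem_shell.1 hx⟩
  have h1 := h.left_pos.ne
  have h2 := h.right_pos.ne
  rw [numSpheres, e, Finset.card_insert_of_notMem (by simp [h1, h2]),
    Finset.card_insert_of_notMem (by simp [h.ne]), Finset.card_singleton]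

lemma Shells.coe_sdiff (h : Shells X w r ρ) :
    (X : Set (Rn n)) \ {0} = (shell X r : Set (Rn n)) ∪ (shell X ρ : Set (Rn n)) := by
  ext x
  simp only [Set.mem_sdiff, Finset.mem_coe, Set.mem_singleton_iff, Set.mem_union]
  constructor
  · rintro ⟨hx, hx0⟩
    exact (h.cover x hx hx0).imp (fun hh => mem_shell.2 ⟨hx, hh⟩) (fun hh => mem_shell.2 ⟨hx, hh⟩)
  · rintro (hx | hx)
    · exact ⟨(mem_shell.1 hx).1, h.ne_zero hx⟩
    · exact ⟨(mem_shell.1 hx).1, h.symm.ne_zero hx⟩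

end shells

/-! ### The plane -/

lemma mem_octagon₁_of_sin (r : ℝ) {θ : ℝ} (h : Real.sin (4 * θ) = 0) :
    r • !₂[Real.cos θ, Real.sin θ] ∈ octagon₁ r := by
  obtain ⟨m, hm⟩ := Real.sin_eq_zero_iff.1 h
  obtain ⟨k, hk⟩ := Int.eq_ofNat_of_zero_le (Int.emod_nonneg m (show (8 : ℤ) ≠ 0 by norm_num))
  have hk7 := Int.emod_lt_of_pos m (show (0 : ℤ) < 8 by norm_num)
  have hmk : (m : ℝ) = 8 * (m / 8 : ℤ) + k := by
    have := Int.mul_ediv_add_emod m 8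
    rw [hk] at this
    exact_mod_cast this.symm
  refine ⟨k, by omega, ?_⟩
  have hθ : θ = 2 * k * Real.pi / 8 + (m / 8 : ℤ) * (2 * Real.pi) := by
    rw [hmk] at hm
    linarith
  rw [hθ, Real.cos_add_int_mul_two_pi, Real.sin_add_int_mul_two_pi]

lemma mem_octagon₂_of_cos (r : ℝ) {θ : ℝ} (h : Real.cos (4 * θ) = 0) :
    r • !₂[Real.cos θ, Real.sin θ] ∈ octagon₂ r := by
  obtain ⟨m, hm⟩ := Real.cos_eq_zero_iff.1 h
  obtain ⟨k, hk⟩ := Int.eq_ofNat_of_zero_le (Int.emod_nonneg m (show (8 : ℤ) ≠ 0 by norm_num))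
  have hk7 := Int.emod_lt_of_pos m (show (0 : ℤ) < 8 by norm_num)
  have hmk : (m : ℝ) = 8 * (m / 8 : ℤ) + k := by
    have := Int.mul_ediv_add_emod m 8
    rw [hk] at this
    exact_mod_cast this.symm
  refine ⟨k, by omega, ?_⟩
  have hθ : θ = (2 * k + 1) * Real.pi / 8 + (m / 8 : ℤ) * (2 * Real.pi) := by
    rw [hmk] at hm
    linarith
  rw [hθ, Real.cos_add_int_mul_two_pi, Real.sin_add_int_mul_two_pi]

lemma octagon₁_eq_image (r : ℝ) : octagon₁ r = ((Finset.range 8).image fun k : ℕ =>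
    r • !₂[Real.cos (2 * k * Real.pi / 8), Real.sin (2 * k * Real.pi / 8)] : Finset (Rn 2)) := by
  ext y
  simp only [octagon₁, Set.mem_ofPred_eq, Finset.coe_image, Set.mem_image, Finset.coe_range,
    Set.mem_Iio]
  exact ⟨fun ⟨k, hk, e⟩ => ⟨k, by omega, e.symm⟩, fun ⟨k, hk, e⟩ => ⟨k, by omega, e.symm⟩⟩

lemma octagon₂_eq_image (r : ℝ) : octagon₂ r = ((Finset.range 8).image fun k : ℕ =>
    r • !₂[Real.cos ((2 * k + 1) * Real.pi / 8), Real.sin ((2 * k + 1) * Real.pi / 8)] :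
      Finset (Rn 2)) := by
  ext y
  simp only [octagon₂, Set.mem_ofPred_eq, Finset.coe_image, Set.mem_image, Finset.coe_range,
    Set.mem_Iio]
  exact ⟨fun ⟨k, hk, e⟩ => ⟨k, by omega, e.symm⟩, fun ⟨k, hk, e⟩ => ⟨k, by omega, e.symm⟩⟩

/-- A set of eight points mapped by an injection into at most eight points covers them. -/
lemma coe_eq_image_of_card {α β : Type*} [DecidableEq α] [DecidableEq β] {S : Finset α}
    {O : Finset β} {f : β ≃ α} (hS : ∀ x ∈ S, f.symm x ∈ O) (hc : O.card ≤ S.card) :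
    (S : Set α) = f '' O := by
  have h1 : S.image f.symm = O := by
    refine Finset.eq_of_subset_of_card_le ?_ ?_
    · intro y hy
      obtain ⟨x, hx, rfl⟩ := Finset.mem_image.1 hy
      exact hS x hx
    · rwa [Finset.card_image_of_injective _ f.symm.injective]
  rw [← h1]
  ext x
  simp

lemma exists_polar (y : Rn 2) : ∃ θ : ℝ, y = ‖y‖ • !₂[Real.cos θ, Real.sin θ] := by
  refine ⟨Complex.arg ⟨y 0, y 1⟩, ?_⟩
  have hn : ‖(⟨y 0, y 1⟩ : ℂ)‖ = ‖y‖ := by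
    rw [EuclideanSpace.norm_eq, Complex.norm_def, Complex.normSq_apply]
    simp [sq]
  have h1 := Complex.norm_mul_cos_arg ⟨y 0, y 1⟩
  have h2 := Complex.norm_mul_sin_arg ⟨y 0, y 1⟩
  rw [hn] at h1 h2
  ext i
  fin_cases i
  · simpa using h1.symm
  · simpa using h2.symm

section plane

variable {X : Finset (Rn 2)} {w : Rn 2 → ℝ} {r ρ : ℝ}

/-- Half a shell has `2 * share + 3` points, an integer strictly between 3 and 5. -/
lemma Shells.share_eq_half (h : Shells X w r ρ) : share X w r ρ = 1 / 2 := by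
  obtain ⟨l, hl⟩ := exists_inner_ne_zero X
  have h1 := h.card_shell
  rw [h.card_shell_eq hl] at h1
  have h2 := h.share_pos
  have h3 := h.symm.share_pos
  have h4 := h.share_add
  have e : diag X w r ρ = 2 * share X w r ρ + 3 := by
    rw [diag, zonal₄, zonal₂]; norm_num; ring
  rw [e] at h1
  push_cast at h1
  have h5 : ((halfShell X l r).card : ℝ) = 2 * share X w r ρ + 3 := by linarith
  have h6 : (3 : ℝ) < (halfShell X l r).card := by linarith
  have h7 : ((halfShell X l r).card : ℝ) < 5 := by linarith
  have h8 : (halfShell X l r).card = 4 := by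
    have h6' : 3 < (halfShell X l r).card := by exact_mod_cast h6
    have h7' : (halfShell X l r).card < 5 := by exact_mod_cast h7
    omega
  rw [h8] at h5
  push_cast at h5
  linarith

lemma Shells.diag_eq_four (h : Shells X w r ρ) : diag X w r ρ = 4 := by
  rw [diag, h.share_eq_half, zonal₄, zonal₂]; norm_num

lemma Shells.card_eq_eight (h : Shells X w r ρ) : (shell X r).card = 8 := by
  have h1 := h.card_shell
  rw [h.diag_eq_four] at h1
  have h2 : ((shell X r).card : ℝ) = (8 : ℕ) := by rw [h1]; norm_num
  exact_mod_cast h2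

lemma Shells.weight_eq (h : Shells X w r ρ) {x : Rn 2} (hx : x ∈ shell X r) :
    w x = mass X w r / 8 := by
  have h1 := h.two_mul_weight hx
  rw [h.diag_eq_four] at h1
  linarith

lemma Shells.mass_mul_pow (h : Shells X w r ρ) : mass X w r * r ^ 8 = mass X w ρ * ρ ^ 8 := by
  have h1 := h.share_eq_half
  have h2 := h.symm.share_eq_half
  have h3 := h.mass₈_pos
  rw [share, div_eq_iff h3.ne'] at h1
  rw [share, mass₈_comm, div_eq_iff h3.ne'] at h2
  rw [h1, h2]

/-- The classification in the plane. -/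
lemma Shells.similar (h : Shells X w r ρ) :
    Similar ((X : Set (Rn 2)) \ {0}) w (octagon₁ r ∪ octagon₂ ρ)
      (octagonWeight r ρ (mass X w r / 8)) := by
  classical
  have hr := h.left_pos
  have hρ := h.right_pos
  obtain ⟨x, hx⟩ := h.left_nonempty
  have hxr : ‖x‖ = r := (mem_shell.1 hx).2
  set E : Rn 2 := r • !₂[1, 0] with hE
  have hEn : ‖E‖ = ‖x‖ := by
    rw [hxr, hE, norm_smul, EuclideanSpace.norm_eq]
    simp [abs_of_pos hr]
  set σ : Rn 2 ≃ₗᵢ[ℝ] Rn 2 := Submodule.reflection (ℝ ∙ (E - x))ᗮ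
  have hσ : σ E = x := Submodule.reflection_sub hEn
  have hpolar : ∀ z ∈ X, z ≠ 0 → ∃ θ : ℝ, σ.symm z = ‖z‖ • !₂[Real.cos θ, Real.sin θ] ∧
      cosSq x z = Real.cos θ ^ 2 := by
    intro z hz hz0
    obtain ⟨θ, hθ⟩ := exists_polar (σ.symm z)
    rw [LinearIsometryEquiv.norm_map] at hθ
    refine ⟨θ, hθ, ?_⟩
    have hz' := norm_ne_zero_iff.2 hz0
    have hin : ⟪x, z⟫ = r * (‖z‖ * Real.cos θ) := by
      rw [← hσ, ← σ.symm.inner_map_map, σ.symm_apply_apply, hθ, hE, real_inner_smul_left,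
        real_inner_smul_right]
      simp [PiLp.inner_apply]
    rw [cosSq, hin, hxr]
    field_simp
  have ho1 : (shell X r : Set (Rn 2)) = σ.toEquiv '' (octagon₁ r) := by
    rw [octagon₁_eq_image]
    refine coe_eq_image_of_card (f := σ.toEquiv) (fun z hz => ?_) ?_
    · rw [← Finset.mem_coe, ← octagon₁_eq_image]
      obtain ⟨θ, hθ, hc⟩ := hpolar z (mem_shell.1 hz).1 (h.ne_zero hz)
      -- For n = 2 and share 1/2 the kernel is 4u(2u - 1) with u = cos²θ. The factor 1 - u accounts
      -- for x and -x.
      have hs : Real.sin (4 * θ) = 0 := by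
        have e4 : Real.sin (4 * θ) ^ 2 =
            16 * (1 - cosSq x z) * cosSq x z * (2 * cosSq x z - 1) ^ 2 := by
          rw [hc, show 4 * θ = 2 * (2 * θ) by ring, Real.sin_two_mul, Real.sin_two_mul,
            Real.cos_two_mul, ← Real.sin_sq]
          ring
        have hu : (1 - cosSq x z) * cosSq x z * (2 * cosSq x z - 1) = 0 := by
          by_cases h1 : z = x
          · rw [h1, cosSq_self (h.ne_zero hx)]; ring
          by_cases h2 : z = -x
          · rw [h2, cosSq_neg_right, cosSq_self (h.ne_zero hx)]; ring
          have := (h.kernel_eq_zero hx).1 z hz h1 h2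
          rw [h.share_eq_half, zonal₄, zonal₂] at this
          norm_num at this
          linear_combination (1 - cosSq x z) / 4 * this
        rw [← sq_eq_zero_iff, e4]
        linear_combination (16 * (2 * cosSq x z - 1)) * hu
      have := mem_octagon₁_of_sin r hs
      rw [← (mem_shell.1 hz).2] at this ⊢
      rw [← hθ] at this
      exact this
    · rw [h.card_eq_eight]
      exact Finset.card_image_le.trans (by simp)
  have ho2 : (shell X ρ : Set (Rn 2)) = σ.toEquiv '' (octagon₂ ρ) := by
    rw [octagon₂_eq_image]
    refine coe_eq_image_of_card (f := σ.toEquiv) (fun z hz => ?_) ?_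
    · rw [← Finset.mem_coe, ← octagon₂_eq_image]
      obtain ⟨θ, hθ, hc⟩ := hpolar z (mem_shell.1 hz).1 (h.symm.ne_zero hz)
      -- For n = 2, `zonal₄` at cos²θ is 2 cos 4θ.
      have hs : Real.cos (4 * θ) = 0 := by
        have := (h.kernel_eq_zero hx).2 z hz
        rw [zonal₄, hc] at this
        norm_num at this
        rw [show 4 * θ = 2 * (2 * θ) by ring, Real.cos_two_mul, Real.cos_two_mul]
        linear_combination this / 2
      have := mem_octagon₂_of_cos ρ hs
      rw [← (mem_shell.1 hz).2] at this ⊢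
      rw [← hθ] at this
      exact this
    · rw [h.symm.card_eq_eight]
      exact Finset.card_image_le.trans (by simp)
  refine ⟨σ, 1, 1, one_pos, one_pos, ?_, ?_⟩
  · rw [h.coe_sdiff, ho1, ho2, Set.image_union]
    simp
  · intro y hy
    rw [one_smul, one_mul]
    by_cases hy1 : y ∈ octagon₁ r
    · rw [octagonWeight, if_pos hy1]
      have : σ y ∈ (shell X r : Set (Rn 2)) := by
        rw [ho1]; exact ⟨y, hy1, rfl⟩
      exact h.weight_eq this
    · have hy2 := hy.resolve_left hy1
      rw [octagonWeight, if_neg hy1]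
      have : σ y ∈ (shell X ρ : Set (Rn 2)) := by
        rw [ho2]; exact ⟨y, hy2, rfl⟩
      rw [h.symm.weight_eq this]
      have := h.mass_mul_pow
      field_simp
      linear_combination -this

end plane

/-! ### The arithmetic of the eigenvalues -/

/-- The equation is Pell's (2n + 3)² - 24t² = 1, whose solutions with n > 0 begin with (n, t) = (1,
1), (23, 10), (241, 99). -/
lemma eq_or_le_of_mul_eq_six_mul_sq {n t : ℕ} (hn : 3 ≤ n) (h : (n + 1) * (n + 2) = 6 * t ^ 2) :
    (n = 23 ∧ t = 10) ∨ (241 ≤ n ∧ 99 ≤ t) := by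
  by_cases h241 : 241 ≤ n
  · right
    refine ⟨h241, ?_⟩
    by_contra! hlt
    nlinarith
  · left
    -- A finite check: 6(n + 1)(n + 2) = (6t)² has to be a perfect square.
    have key : ∀ n < 241, 3 ≤ n → n ≠ 23 →
        Nat.sqrt (6 * (n + 1) * (n + 2)) * Nat.sqrt (6 * (n + 1) * (n + 2)) ≠
          6 * (n + 1) * (n + 2) := by
      decide +kernel
    have h23 : n = 23 := by
      by_contra hne
      apply key n (by omega) hn hne
      rw [show 6 * (n + 1) * (n + 2) = (6 * t) * (6 * t) by linear_combination 6 * h, Nat.sqrt_eq]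
    refine ⟨h23, ?_⟩
    subst h23
    have : t ^ 2 = 10 ^ 2 := by omega
    exact Nat.pow_left_injective (n := 2) (by norm_num) this

/-- The relation between the dimension, the integer `y` and the parameter `a` of a shell, with
`(n + 1) (n + 2) = 6 t²`. -/
def EigenRel (n t y a : ℝ) : Prop :=
  y ^ 2 * (a ^ 2 - a / 3 + (n + 2) / (24 * (n + 1))) =
    t ^ 2 * a ^ 2 + (n + 2) / 6 * a + (n + 2) / (24 * (n + 1))

section

variable {n t y a : ℝ}

lemma EigenRel.quad_pos (hn : 0 < n) : 0 < a ^ 2 - a / 3 + (n + 2) / (24 * (n + 1)) := by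
  have : 1 / 24 < (n + 2) / (24 * (n + 1)) := by
    rw [div_lt_div_iff₀ (by norm_num) (by positivity)]; linarith
  nlinarith [sq_nonneg (a - 1 / 6)]

lemma EigenRel.of_le {s : ℝ} (h : EigenRel n t y a) (hn : 0 < n) (hs : 0 ≤ s) (hsy : s ≤ y) :
    s ^ 2 * (a ^ 2 - a / 3 + (n + 2) / (24 * (n + 1))) ≤
      t ^ 2 * a ^ 2 + (n + 2) / 6 * a + (n + 2) / (24 * (n + 1)) := by
  rw [← h]
  exact mul_le_mul_of_nonneg_right (pow_le_pow_left₀ hs hsy 2) (EigenRel.quad_pos hn).le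

lemma EigenRel.of_ge {s : ℝ} (h : EigenRel n t y a) (hn : 0 < n) (hy : 0 ≤ y) (hsy : y ≤ s) :
    t ^ 2 * a ^ 2 + (n + 2) / 6 * a + (n + 2) / (24 * (n + 1)) ≤
      s ^ 2 * (a ^ 2 - a / 3 + (n + 2) / (24 * (n + 1))) := by
  rw [← h]
  exact mul_le_mul_of_nonneg_right (pow_le_pow_left₀ hy hsy 2) (EigenRel.quad_pos hn).le

/-- The upper bound is the value at n = 23, the smallest dimension that remains. -/
lemma kappa_bounds (hn : 23 ≤ n) : 1 / 24 < (n + 2) / (24 * (n + 1)) ∧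
    (n + 2) / (24 * (n + 1)) ≤ 25 / 576 := by
  constructor
  · rw [div_lt_div_iff₀ (by norm_num) (by positivity)]; linarith
  · rw [div_le_div_iff₀ (by positivity) (by norm_num)]; linarith

lemma EigenRel.lt (h : EigenRel n t y a) (hn : 23 ≤ n) (ha : 1 / 3 ≤ a)
    (hy : 0 ≤ y) : t < y := by
  by_contra! hle
  have h1 := h.of_ge (by linarith) hy hle
  obtain ⟨k1, k2⟩ := kappa_bounds hn
  generalize (n + 2) / (24 * (n + 1)) = κ at *
  nlinarith [mul_nonneg (sq_nonneg t) (show 0 ≤ a / 3 - κ by linarith)]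

/-- From y ≥ t + 2 follows (4t + 4) a < (t + 2)²/3 + (n + 2)/6, where 4t + 4 = (t + 2)² - t². This
contradicts the lower bound on a. -/
lemma EigenRel.lt_add_two (h : EigenRel n t y a) (hn : 23 ≤ n) (ht : 10 ≤ t)
    (hnt : 2 * t + 3 ≤ n) (ha : (n + 6) / 24 ≤ a) : y < t + 2 := by
  by_contra! hle
  have h1 := h.of_le (by linarith) (by linarith) hle
  obtain ⟨k1, k2⟩ := kappa_bounds hn
  generalize (n + 2) / (24 * (n + 1)) = κ at *
  have ha0 : 0 < a := by linarith
  have h2 : (4 * t + 4) * a ^ 2 + ((t + 2) ^ 2 - 1) * κ ≤ a * ((t + 2) ^ 2 / 3 + (n + 2) / 6) := by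
    linarith
  have h3 : (4 * t + 4) * a ^ 2 < a * ((t + 2) ^ 2 / 3 + (n + 2) / 6) := by
    have : 0 < ((t + 2) ^ 2 - 1) * κ := mul_pos (by nlinarith) (by linarith)
    linarith
  have h4 : (4 * t + 4) * a < (t + 2) ^ 2 / 3 + (n + 2) / 6 := by
    apply lt_of_mul_lt_mul_left _ ha0.le
    linarith
  have h5 : (4 * t + 4) * ((n + 6) / 24) ≤ (4 * t + 4) * a :=
    mul_le_mul_of_nonneg_left ha (by linarith)
  nlinarith [mul_le_mul_of_nonneg_left hnt (show (0 : ℝ) ≤ t by linarith)]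

end

/-- The relation for a is a quadratic with larger root about 1.9947. Then b is about 0.422, which
puts y strictly between 15 and 16. -/
lemma not_eigenRel_small {y : ℤ} {a b : ℝ} (ha : 29 / 24 ≤ a) (hab : a + b = 29 / 12) (hb : 1 / 3 ≤ b)
    (h1 : EigenRel 23 10 11 a) (h2 : EigenRel 23 10 y b) (hy : 0 ≤ y) : False := by
  simp only [EigenRel] at h1
  norm_num at h1
  have hq : 21 * a ^ 2 - 89 / 2 * a + 125 / 24 = 0 := by linarith
  have hl : 199 / 100 < a := by
    by_contra! hcon
    nlinarith
  have hu : a < 1995 / 1000 := by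
    by_contra! hcon
    nlinarith
  have hy' : (0 : ℝ) ≤ y := by exact_mod_cast hy
  rcases le_or_gt y 15 with h | h
  · have := h2.of_ge (s := 15) (by norm_num) hy' (by exact_mod_cast h)
    norm_num at this
    nlinarith
  · have := h2.of_le (s := 16) (by norm_num) (by norm_num) (by exact_mod_cast h)
    norm_num at this
    nlinarith

section

variable {n t a b κ : ℝ}

/-- Since (n + 3/2)² = 6t² + 1/4, n is close to √6 t - 3/2. The two constants enclose √6. -/
lemma lower_of_mul_eq (ht : 99 ≤ t) (hn : 241 ≤ n) (h : (n + 1) * (n + 2) = 6 * t ^ 2) :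
    24494 / 10000 * t - 3 / 2 ≤ n := by
  by_contra! hcon
  nlinarith

lemma upper_of_mul_eq (ht : 99 ≤ t) (h : (n + 1) * (n + 2) = 6 * t ^ 2) :
    n ≤ 2450 / 1000 * t - 3 / 2 := by
  by_contra! hcon
  nlinarith

lemma mul_le_of_root (ht : 99 ≤ t) (hκ : 0 ≤ κ) (ha : 0 < a)
    (hq : (2 * t + 1) * a ^ 2 - ((t + 1) ^ 2 / 3 + (n + 2) / 6) * a + κ * (t ^ 2 + 2 * t) = 0) :
    (2 * t + 1) * a ≤ (t + 1) ^ 2 / 3 + (n + 2) / 6 := by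
  have : 0 ≤ κ * (t ^ 2 + 2 * t) := by positivity
  apply le_of_mul_le_mul_right _ ha
  linarith

/-- The inequality that rules out y ≥ t + 5 for the smaller parameter; 10t + 25 is (t + 5)² - t². -/
lemma le_mul_of_add_eq (ht : 99 ≤ t) (hlo : 24494 / 10000 * t - 3 / 2 ≤ n)
    (hau : (2 * t + 1) * a ≤ (t + 1) ^ 2 / 3 + (n + 2) / 6) (hab : a + b = (n + 6) / 12) :
    (t + 5) ^ 2 / 3 + (n + 2) / 6 ≤ (10 * t + 25) * b := by
  have e : b = (n + 6) / 12 - a := by linarith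
  rw [e]
  have hpos : (0 : ℝ) < 2 * t + 1 := by linarith
  apply le_of_mul_le_mul_left _ hpos
  have h6 := mul_le_mul_of_nonneg_left hau (show (0 : ℝ) ≤ 10 * t + 25 by linarith)
  have h7 : (2 * t + 1) * ((t + 5) ^ 2 / 3 + (n + 2) / 6) ≤
      (10 * t + 25) * ((2 * t + 1) * ((n + 6) / 12) - ((t + 1) ^ 2 / 3 + (n + 2) / 6)) := by
    clear h6 hau hab e
    obtain ⟨e, he, rfl⟩ : ∃ e, 0 ≤ e ∧ n = 24494 / 10000 * t - 3 / 2 + e :=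
      ⟨n - (24494 / 10000 * t - 3 / 2), by linarith, by ring⟩
    obtain ⟨d, hd, rfl⟩ : ∃ d, 0 ≤ d ∧ t = 99 + d := ⟨t - 99, by linarith, by ring⟩
    have h1 := mul_nonneg he hd
    have h2 := mul_nonneg he (mul_nonneg hd hd)
    have h3 := mul_nonneg hd hd
    have h4 := mul_nonneg hd (mul_nonneg hd hd)
    linarith
  linarith

lemma le_root (ht : 99 ≤ t) (hlo : 24494 / 10000 * t - 3 / 2 ≤ n)
    (hhi : n ≤ 2450 / 1000 * t - 3 / 2) (hκ : κ ≤ 25 / 576) (ha : (n + 6) / 24 ≤ a)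
    (hq : (2 * t + 1) * a ^ 2 - ((t + 1) ^ 2 / 3 + (n + 2) / 6) * a + κ * (t ^ 2 + 2 * t) = 0) :
    t / 6 ≤ a := by
  by_contra! hcon
  have h10 : t / 10 ≤ a := by linarith
  have ht2 := mul_le_mul_of_nonneg_right ht (show (0 : ℝ) ≤ t by linarith)
  -- Convexity: on [t/10, t/6] the square of a lies below its chord, of slope 4t/15, which makes the
  -- quadratic negative there.
  have hconv := mul_nonneg (sub_nonneg.2 h10) (sub_nonneg.2 hcon.le)
  have hc2 := mul_nonneg hconv (show (0 : ℝ) ≤ 2 * t + 1 by linarith)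
  have hκ' : κ * (t ^ 2 + 2 * t) ≤ 25 / 576 * (t ^ 2 + 2 * t) :=
    mul_le_mul_of_nonneg_right hκ (by positivity)
  have hc : 0 ≤ (2 * t + 1) * (4 / 15 * t) - ((t + 1) ^ 2 / 3 + (n + 2) / 6) := by linarith
  have hc3 := mul_le_mul_of_nonneg_left hcon.le hc
  have htn := mul_le_mul_of_nonneg_left hlo (show (0 : ℝ) ≤ t by linarith)
  linarith

/-- Rules out y ≤ t + 4, with 8t + 16 = (t + 4)² - t². The bound 413/10000 t exceeds (n + 6)/12 -
t/6 as soon as t ≥ 99. -/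
lemma quad_neg_of_mem (ht : 99 ≤ t) (hlo : 24494 / 10000 * t - 3 / 2 ≤ n)
    (hhi : n ≤ 2450 / 1000 * t - 3 / 2) (hκ : κ ≤ 25 / 576) (hbl : t / 30 ≤ b)
    (hbu : b ≤ 413 / 10000 * t) :
    (8 * t + 16) * b ^ 2 - ((t + 4) ^ 2 / 3 + (n + 2) / 6) * b + κ * ((t + 4) ^ 2 - 1) < 0 := by
  have ht2 := mul_le_mul_of_nonneg_right ht (show (0 : ℝ) ≤ t by linarith)
  have ht3 := mul_le_mul_of_nonneg_right ht2 (show (0 : ℝ) ≤ t by linarith)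
  have hconv := mul_nonneg (sub_nonneg.2 hbl) (sub_nonneg.2 hbu)
  have hc2 := mul_nonneg hconv (show (0 : ℝ) ≤ 8 * t + 16 by linarith)
  have hκ' : κ * ((t + 4) ^ 2 - 1) ≤ 25 / 576 * ((t + 4) ^ 2 - 1) :=
    mul_le_mul_of_nonneg_right hκ (by linarith)
  have hc : 0 ≤ (8 * t + 16) * (t / 30 + 413 / 10000 * t) - ((t + 4) ^ 2 / 3 + (n + 2) / 6) := by
    linarith
  have hc3 := mul_le_mul_of_nonneg_left hbu hc
  have htn := mul_le_mul_of_nonneg_left hlo (show (0 : ℝ) ≤ t by linarith)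
  linarith

lemma not_eigenRel_large {t y : ℤ} (ht : 99 ≤ (t : ℝ)) (hn : 241 ≤ n)
    (hnt : (n + 1) * (n + 2) = 6 * (t : ℝ) ^ 2) (ha : (n + 6) / 24 ≤ a)
    (hab : a + b = (n + 6) / 12) (hb : 1 / 3 ≤ b)
    (h1 : EigenRel n t (t + 1) a) (h2 : EigenRel n t y b) (hy : 0 ≤ y) : False := by
  have hy' : (0 : ℝ) ≤ y := by exact_mod_cast hy
  have hlo := lower_of_mul_eq ht hn hnt
  have hhi := upper_of_mul_eq ht hnt
  obtain ⟨k1, k2⟩ := kappa_bounds (n := n) (by linarith)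
  have hq : (2 * t + 1) * a ^ 2 - ((t + 1) ^ 2 / 3 + (n + 2) / 6) * a +
      (n + 2) / (24 * (n + 1)) * ((t : ℝ) ^ 2 + 2 * t) = 0 := by
    rw [EigenRel] at h1
    linear_combination h1
  have hbl := le_mul_of_add_eq ht hlo (mul_le_of_root ht (by linarith) (by linarith) hq) hab
  rcases (show y ≤ t + 4 ∨ t + 5 ≤ y by omega) with h | h
  · have h4 := h2.of_ge (s := t + 4) (by linarith) hy' (by exact_mod_cast h)
    have hal := le_root ht hlo hhi k2 ha hq
    have hbl' : (t : ℝ) / 30 ≤ b := by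
      apply le_of_mul_le_mul_left _ (show (0 : ℝ) < 10 * t + 25 by linarith)
      linarith
    have := quad_neg_of_mem ht hlo hhi k2 hbl' (by linarith)
    linarith
  · have h5 := h2.of_le (s := t + 5) (by linarith) (by linarith) (by exact_mod_cast h)
    have h6 := mul_le_mul_of_nonneg_right hbl (show 0 ≤ b by linarith)
    have h7 : 0 < (n + 2) / (24 * (n + 1)) * (((t : ℝ) + 5) ^ 2 - 1) :=
      mul_pos (by linarith) (by nlinarith)
    linarith

end

/-- No dimension `n ≥ 3` admits a solution of the eigenvalue relations for both shells. -/
lemma not_eigenRel {n t : ℕ} {y z : ℤ} {a b : ℝ} (hn : 3 ≤ n)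
    (hnt : (n + 1) * (n + 2) = 6 * t ^ 2) (ha : 1 / 3 ≤ a) (hb : 1 / 3 ≤ b)
    (hab : a + b = (n + 6) / 12) (h1 : EigenRel n t y a) (h2 : EigenRel n t z b)
    (hy : 0 ≤ y) (hz : 0 ≤ z) : False := by
  wlog hle : b ≤ a generalizing a b y z
  · exact this hb ha (by rw [add_comm, hab]) h2 h1 hz hy (le_of_not_ge hle)
  have ha' : ((n : ℝ) + 6) / 24 ≤ a := by linarith
  have hcases := eq_or_le_of_mul_eq_six_mul_sq hn hnt
  have h23 : (23 : ℝ) ≤ n := by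
    have : 23 ≤ n := by omega
    exact_mod_cast this
  have h10 : (10 : ℝ) ≤ t := by
    have : 10 ≤ t := by omega
    exact_mod_cast this
  have h3 : 2 * (t : ℝ) + 3 ≤ n := by
    have : 2 * t + 3 ≤ n := by
      by_contra! hcon
      have : 10 ≤ t := by omega
      nlinarith
    exact_mod_cast this
  have hy' : (0 : ℝ) ≤ y := by exact_mod_cast hy
  have hy1 := h1.lt h23 ha hy'
  have hy2 := h1.lt_add_two h23 h10 h3 ha'
  have hyt : y = t + 1 := by
    have e1 : (t : ℤ) < y := by exact_mod_cast hy1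
    have e2 : y < t + 2 := by exact_mod_cast hy2
    omega
  rcases hcases with ⟨rfl, rfl⟩ | ⟨h241, h99⟩
  · subst hyt
    norm_num at h1 h2 ha' hab
    exact not_eigenRel_small ha' hab hb h1 h2 hz
  · subst hyt
    push_cast at h1
    refine not_eigenRel_large (n := n) (t := t) (y := z) (by exact_mod_cast h99)
      (by exact_mod_cast h241) (by exact_mod_cast hnt) ha' hab hb ?_ ?_ hz
    · exact_mod_cast h1
    · exact_mod_cast h2

/-! ### Integrality of eigenvalues and rationality of roots -/

/-- A rational eigenvalue of an integer matrix is an integer. -/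
lemma exists_int_of_eigenvalue {ι : Type*} [Fintype ι] [DecidableEq ι] (A : Matrix ι ι ℤ)
    {f : ι → ℝ} (hf : f ≠ 0) {y : ℝ} (hA : (A.map (Int.cast : ℤ → ℝ)).mulVec f = y • f)
    (hy : ∃ q : ℚ, y = q) : ∃ m : ℤ, y = m := by
  obtain ⟨q, rfl⟩ := hy
  have hdet : (Matrix.scalar ι (q : ℝ) - A.map (Int.cast : ℤ → ℝ)).det = 0 := by
    refine Matrix.exists_mulVec_eq_zero_iff.1 ⟨f, hf, ?_⟩
    rw [Matrix.sub_mulVec, hA]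
    ext i
    simp [Matrix.scalar_apply]
  have hroot : Polynomial.eval (q : ℝ) (A.map (Int.castRingHom ℝ)).charpoly = 0 := by
    rw [Matrix.eval_charpoly]
    exact hdet
  rw [Matrix.charpoly_map, Polynomial.eval_map] at hroot
  have hint : IsIntegral ℤ (q : ℝ) := ⟨A.charpoly, A.charpoly_monic, hroot⟩
  have hint' : IsIntegral ℤ q :=
    (isIntegral_algebraMap_iff (A := ℚ) (B := ℝ) (algebraMap ℚ ℝ).injective).1 (by simpa using hint)
  obtain ⟨m, hm⟩ := IsIntegrallyClosed.isIntegral_iff.1 hint'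
  exact ⟨m, by rw [← hm]; simp⟩

/-- A sum of numbers `± s` is an integer multiple of `s`. -/
lemma exists_int_sum_eq {ι : Type*} (T : Finset ι) {v : ι → ℝ} {s : ℝ}
    (h : ∀ i ∈ T, v i ^ 2 = s ^ 2) : ∃ k : ℤ, ∑ i ∈ T, v i = k * s := by
  classical
  induction T using Finset.induction_on with
  | empty => exact ⟨0, by simp⟩
  | insert i T hi ih =>
    obtain ⟨k, hk⟩ := ih fun j hj => h j (Finset.mem_insert_of_mem hj)
    rw [Finset.sum_insert hi, hk]
    rcases sq_eq_sq_iff_eq_or_eq_neg.1 (h i (Finset.mem_insert_self i T)) with h1 | h1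
    · exact ⟨k + 1, by rw [h1]; push_cast; ring⟩
    · exact ⟨k - 1, by rw [h1]; push_cast; ring⟩

/-- The sum is an integer multiple of s, and a nonzero rational one excludes an irrational s. -/
lemma exists_ratio_of_sum {ι : Type*} (T : Finset ι) {v : ι → ℝ} {s : ℝ}
    (h : ∀ i ∈ T, v i ^ 2 = s ^ 2) {q : ℚ} (hq : ∑ i ∈ T, v i = q) (hq0 : q ≠ 0) :
    ∃ p : ℚ, s = p := by
  obtain ⟨k, hk⟩ := exists_int_sum_eq T h
  have hk0 : (k : ℝ) ≠ 0 := by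
    intro h0
    rw [h0, zero_mul, hq] at hk
    exact hq0 (by exact_mod_cast hk)
  refine ⟨q / k, ?_⟩
  push_cast
  rw [eq_div_iff hk0, ← hq, hk, mul_comm]

/-! ### Nonexistence in dimension at least three -/

section shells

variable {n : ℕ} {X : Finset (Rn n)} {w : Rn n → ℝ} {r ρ : ℝ}

/-- In dimension at least three, orthogonality relations between the shells force
`6 (n + 1) (n + 2)` to be a square. -/
lemma Shells.exists_mul_eq (h : Shells X w r ρ) (hn : 3 ≤ n) :
    ∃ t : ℕ, (n + 1) * (n + 2) = 6 * t ^ 2 := by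
  have hn0 := h.cast_pos
  have hn3 : (3 : ℝ) ≤ n := by exact_mod_cast hn
  obtain ⟨x, hx⟩ := h.left_nonempty
  have hx0 := h.ne_zero hx
  set S : ℕ := 6 * (n + 1) * (n + 2) with hS
  -- The quadratic `zonal₄ = 0` with its square completed; S is its reduced discriminant.
  have hv : ∀ z ∈ shell X ρ, ((n + 4) * (n + 2) * cosSq x z - 3 * (n + 2)) ^ 2 = √(S : ℝ) ^ 2 := by
    intro z hz
    have h1 := (h.kernel_eq_zero hx).2 z hz
    rw [Real.sq_sqrt (by positivity), hS]
    have h2 : ((n : ℝ) + 4) * (n + 2) * cosSq x z ^ 2 - 6 * (n + 2) * cosSq x z + 3 = 0 := by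
      have hc : (n : ℝ) * (n + 6) / 24 ≠ 0 := by positivity
      apply mul_left_cancel₀ hc
      rw [mul_zero, ← h1, zonal₄]
      ring
    push_cast
    linear_combination ((n : ℝ) + 4) * (n + 2) * h2
  have hcard : (0 : ℝ) < (shell X ρ).card := by
    exact_mod_cast Finset.card_pos.2 h.right_nonempty
  have hsum : ∑ z ∈ shell X ρ, ((n + 4) * (n + 2) * cosSq x z - 3 * (n + 2)) =
      ((-(2 * (shell X ρ).card * (n + 2) * (n - 2)) / n : ℚ) : ℝ) := by
    have h1 := h.symm.sum_cosSq hx0 (k := 1) (by norm_num)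
    simp only [pow_one, moment_one] at h1
    rw [Finset.sum_sub_distrib, ← Finset.mul_sum, h1, Finset.sum_const, nsmul_eq_mul]
    push_cast
    field_simp
    ring
  -- The sum contains the factor n - 2, so the argument breaks down exactly in the plane.
  obtain ⟨p, hp⟩ := exists_ratio_of_sum (shell X ρ) hv hsum (by
    have h1 : (0 : ℚ) < (shell X ρ).card := by exact_mod_cast hcard
    have h2 : (3 : ℚ) ≤ n := by exact_mod_cast hn
    have h3 : (0 : ℚ) < n - 2 := by linarith
    have h4 : (0 : ℚ) < 2 * (shell X ρ).card * (n + 2) * (n - 2) / n := by positivity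
    rw [neg_div]
    exact neg_ne_zero.2 h4.ne')
  have hsq : IsSquare S := by
    by_contra hns
    exact irrational_sqrt_natCast_iff.2 hns ⟨p, hp.symm⟩
  obtain ⟨s, hs⟩ := hsq
  have h6 : 6 ∣ s := by
    have h2 : 2 ∣ s := Nat.prime_two.dvd_of_dvd_pow (n := 2)
      (by rw [sq, ← hs, hS, mul_assoc]; exact Dvd.dvd.mul_right (by norm_num) _)
    have h3 : 3 ∣ s := Nat.prime_three.dvd_of_dvd_pow (n := 2)
      (by rw [sq, ← hs, hS, mul_assoc]; exact Dvd.dvd.mul_right (by norm_num) _)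
    omega
  obtain ⟨t, rfl⟩ := h6
  refine ⟨t, ?_⟩
  have : 6 * ((n + 1) * (n + 2)) = 6 * (6 * t ^ 2) := by
    rw [← mul_assoc, ← hS, hs]; ring
  omega

/-- The lower bound for the size of a spherical `7`-design. -/
lemma Shells.le_card (h : Shells X w r ρ) :
    (n : ℝ) * (n + 1) * (n + 2) / 3 ≤ (shell X r).card := by
  have hn0 := h.cast_pos
  obtain ⟨x, hx⟩ := h.left_nonempty
  have hx0 := h.ne_zero hx
  -- The test function is u((n + 4)u - 3)² in u = cos². It is nonnegative, uses moments up to degree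
  -- 6 only, and equals (n + 1)² at x and -x.
  have e := sum_mul_quartic (shell X r) (fun _ => (1 : ℝ)) (cosSq x) 0 ((n + 4) ^ 2)
    (-6 * (n + 4)) 9 0
  simp only [one_mul] at e
  rw [h.sum_cosSq hx0 (k := 1) (by norm_num), h.sum_cosSq hx0 (k := 2) (by norm_num),
    h.sum_cosSq hx0 (k := 3) (by norm_num), moment_one, moment_two, moment_three] at e
  have e2 : ∑ z ∈ shell X r, cosSq x z * ((n + 4) * cosSq x z - 3) ^ 2 = _ :=
    (Finset.sum_congr rfl fun z _ => by ring).trans e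
  rw [← Finset.add_sum_erase _ _ hx, ← Finset.add_sum_erase _ _
    (Finset.mem_erase.2 ⟨(ne_neg_of_ne_zero hx0).symm, h.neg_mem hx⟩), cosSq_neg_right,
    cosSq_self hx0] at e2
  have hnn : 0 ≤ ∑ z ∈ ((shell X r).erase x).erase (-x),
      cosSq x z * ((n + 4) * cosSq x z - 3) ^ 2 :=
    Finset.sum_nonneg fun z _ => mul_nonneg (sq_nonneg _) (sq_nonneg _)
  have h1 : 2 * ((n : ℝ) + 1) ^ 2 ≤ (shell X r).card * (6 * (n + 1) / (n * (n + 2))) := by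
    have e3 : ((shell X r).card : ℝ) * (6 * (n + 1) / (n * (n + 2))) =
        0 * ∑ i ∈ shell X r, cosSq x i ^ 4 +
        (n + 4) ^ 2 * ((shell X r).card * (15 / (n * (n + 2) * (n + 4)))) +
        -6 * (n + 4) * ((shell X r).card * (3 / (n * (n + 2)))) +
        9 * ((shell X r).card * (1 / n)) + 0 * ∑ i ∈ shell X r, cosSq x i ^ 0 := by
      field_simp
      ring
    rw [e3, ← e2]
    nlinarith
  rw [mul_div_assoc', le_div_iff₀ (by positivity)] at h1
  have hpos : (0 : ℝ) < 6 * (n + 1) := by positivity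
  apply le_of_mul_le_mul_right _ hpos
  linarith

/-- The parameter that governs the angles within a shell. -/
noncomputable def param (X : Finset (Rn n)) (w : Rn n → ℝ) (r ρ : ℝ) : ℝ :=
  share X w r ρ * (n + 6) / 12

lemma Shells.param_add (h : Shells X w r ρ) : param X w r ρ + param X w ρ r = (n + 6) / 12 := by
  have := h.share_add
  rw [param, param]
  linear_combination ((n : ℝ) + 6) / 12 * this

lemma Shells.param_mul (h : Shells X w r ρ) :
    param X w r ρ * (n * (n + 1) * (n - 1)) = (shell X r).card - n * (n + 1) := by
  rw [h.card_shell, diag, param, zonal₄, zonal₂]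
  ring

lemma Shells.third_le_param (h : Shells X w r ρ) (hn : 3 ≤ n) : 1 / 3 ≤ param X w r ρ := by
  have hn3 : (3 : ℝ) ≤ n := by exact_mod_cast hn
  have h1 := h.param_mul
  have h2 := h.le_card
  have hpos : (0 : ℝ) < n * (n + 1) * (n - 1) :=
    mul_pos (by positivity) (by linarith)
  apply le_of_mul_le_mul_right _ hpos
  linarith

/-- The discriminant of the quadratic equation for the squared cosines within a shell. -/
noncomputable def disc (n : ℕ) (a : ℝ) : ℝ :=
  24 * (n + 1) / (n + 2) * (a ^ 2 - a / 3 + (n + 2) / (24 * (n + 1)))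

lemma disc_pos {n : ℕ} (hn : (0 : ℝ) < n) (a : ℝ) : 0 < disc n a :=
  mul_pos (by positivity) (EigenRel.quad_pos hn)

/-- Vanishing of the kernel is a quadratic equation for the squared cosine, here with its square
completed. -/
lemma Shells.sq_eq_disc (h : Shells X w r ρ) {x z : Rn n} (hx : x ∈ shell X r)
    (hz : z ∈ shell X r) (h1 : z ≠ x) (h2 : z ≠ -x) :
    (2 * (n + 4) * param X w r ρ * cosSq x z - (6 * param X w r ρ - 1)) ^ 2 =
      √(disc n (param X w r ρ)) ^ 2 := by
  have hn0 := h.cast_pos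
  have h3 := (h.kernel_eq_zero hx).1 z hz h1 h2
  rw [Real.sq_sqrt (disc_pos hn0 _).le, disc]
  have h4 : param X w r ρ * ((n + 4) * (n + 2) * cosSq x z ^ 2 - 6 * (n + 2) * cosSq x z + 3) +
      (n + 2) * cosSq x z - 1 = 0 := by
    have hc : (n : ℝ) / 2 ≠ 0 := by positivity
    apply mul_left_cancel₀ hc
    rw [mul_zero, ← h3, zonal₄, zonal₂, param]
    ring
  generalize param X w r ρ = a at *
  field_simp
  linear_combination 12 * ((n : ℝ) + 4) * a * h4

lemma Shells.exists_rat_param (h : Shells X w r ρ) (hn : 3 ≤ n) : ∃ q : ℚ, param X w r ρ = q := by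
  have hn3 : (3 : ℝ) ≤ n := by exact_mod_cast hn
  have h1 := h.param_mul
  have hpos : (0 : ℝ) < n * (n + 1) * (n - 1) :=
    mul_pos (by positivity) (by linarith)
  refine ⟨((shell X r).card - n * (n + 1)) / (n * (n + 1) * (n - 1)), ?_⟩
  push_cast
  rw [eq_div_iff hpos.ne', h1]

lemma Shells.exists_rat_sqrt_disc (h : Shells X w r ρ) (hn : 8 ≤ n) :
    ∃ q : ℚ, √(disc n (param X w r ρ)) = q := by
  have hn8 : (8 : ℝ) ≤ n := by exact_mod_cast hn
  obtain ⟨x, hx⟩ := h.left_nonempty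
  have hx0 := h.ne_zero hx
  obtain ⟨a, ha⟩ := h.exists_rat_param (by omega)
  have hmem : -x ∈ (shell X r).erase x :=
    Finset.mem_erase.2 ⟨(ne_neg_of_ne_zero hx0).symm, h.neg_mem hx⟩
  have hv : ∀ z ∈ ((shell X r).erase x).erase (-x),
      (2 * (n + 4) * param X w r ρ * cosSq x z - (6 * param X w r ρ - 1)) ^ 2 =
        √(disc n (param X w r ρ)) ^ 2 := by
    intro z hz
    simp only [Finset.mem_erase] at hz
    exact h.sq_eq_disc hx hz.2.2 hz.2.1 hz.1
  have hsum : ∑ z ∈ ((shell X r).erase x).erase (-x),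
      (2 * (n + 4) * param X w r ρ * cosSq x z - (6 * param X w r ρ - 1)) =
      ((2 * (n + 4) * a * ((shell X r).card / n - 2) - (6 * a - 1) * ((shell X r).card - 2) : ℚ) : ℝ) := by
    have h1 := h.sum_cosSq hx0 (k := 1) (by norm_num)
    simp only [pow_one, moment_one] at h1
    have h2 : ∑ z ∈ shell X r, (2 * (n + 4) * param X w r ρ * cosSq x z - (6 * param X w r ρ - 1)) =
        2 * (n + 4) * param X w r ρ * ((shell X r).card / n) -
          (shell X r).card * (6 * param X w r ρ - 1) := by
      rw [Finset.sum_sub_distrib, ← Finset.mul_sum, h1, Finset.sum_const, nsmul_eq_mul]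
      ring
    rw [← Finset.add_sum_erase _ _ hx, ← Finset.add_sum_erase _ _ hmem, cosSq_neg_right,
      cosSq_self hx0] at h2
    push_cast
    rw [← ha]
    linear_combination h2
  -- The sum is in fact negative: n ≥ 8 gives 2(n + 4) ≤ 3n, and the parameter is at least 1/3.
  refine exists_ratio_of_sum _ hv hsum fun h0 => ?_
  have h0' : 2 * ((n : ℝ) + 4) * param X w r ρ * ((shell X r).card / n - 2) -
      (6 * param X w r ρ - 1) * ((shell X r).card - 2) = 0 := by
    have := congrArg (Rat.cast : ℚ → ℝ) h0
    push_cast at this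
    rw [ha]
    exact this
  have h1 := h.third_le_param (by omega)
  have h2 := h.le_card
  set N : ℝ := ((shell X r).card : ℝ) with hN
  have hNn : 2 * (n : ℝ) ≤ N := by
    have : (n : ℝ) * 6 ≤ n * ((n + 1) * (n + 2)) :=
      mul_le_mul_of_nonneg_left (by nlinarith) (by linarith)
    linarith
  have h3 : 0 ≤ N / n - 2 := by
    rw [sub_nonneg, le_div_iff₀ (by linarith)]; exact hNn
  have h4 : 2 * ((n : ℝ) + 4) * (N / n - 2) ≤ 3 * (N - 2 * n) := by
    have e : 3 * (N - 2 * n) = 3 * n * (N / n - 2) := by field_simp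
    rw [e]
    exact mul_le_mul_of_nonneg_right (by linarith) h3
  have h5 := mul_le_mul_of_nonneg_right h4 (show 0 ≤ param X w r ρ by linarith)
  nlinarith [mul_nonneg (show 0 ≤ param X w r ρ - 1 / 3 by linarith) (show 0 ≤ N - 2 by linarith)]

lemma Shells.mem_halfShell_ne_neg {l x z : Rn n}
    (hx : x ∈ halfShell X l r) (hz : z ∈ halfShell X l r) : z ≠ -x := by
  rintro rfl
  have h1 := (Finset.mem_filter.1 hx).2
  have h2 := (Finset.mem_filter.1 hz).2
  rw [inner_neg_right] at h2
  linarith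

/-- A shell with more than `n²` pairs carries a nontrivial relation between the squared cosines. -/
lemma Shells.exists_relation (h : Shells X w r ρ) {l : Rn n}
    (hc : n ^ 2 < (halfShell X l r).card) : ∃ f : halfShell X l r → ℝ, f ≠ 0 ∧ ∑ z, f z = 0 ∧
      ∀ x : Rn n, ∑ z : halfShell X l r, f z * cosSq x z = 0 := by
  -- T f lists the entries of ∑ f(z) z zᵀ, giving n² linear conditions on more than n² unknowns. The
  -- trace of this matrix yields ∑ f = 0, its quadratic form the relation between squared cosines.
  let T : (halfShell X l r → ℝ) →ₗ[ℝ] (Fin n × Fin n → ℝ) :=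
    { toFun := fun f p => ∑ z : halfShell X l r, f z * (z.1 p.1 * z.1 p.2)
      map_add' := fun f g => by ext p; simp [add_mul, Finset.sum_add_distrib]
      map_smul' := fun c f => by ext p; simp [Finset.mul_sum, mul_assoc] }
  have hlt : Module.finrank ℝ (Fin n × Fin n → ℝ) < Module.finrank ℝ (halfShell X l r → ℝ) := by
    rw [Module.finrank_fintype_fun_eq_card, Module.finrank_fintype_fun_eq_card, Fintype.card_coe,
      Fintype.card_prod, Fintype.card_fin, ← sq]
    exact hc
  obtain ⟨f, hf, hf0⟩ := (Submodule.ne_bot_iff _).1 (LinearMap.ker_ne_bot_of_finrank_lt (f := T) hlt)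
  have hT : ∀ i j, ∑ z : halfShell X l r, f z * (z.1 i * z.1 j) = 0 := fun i j =>
    congrFun (LinearMap.mem_ker.1 hf) (i, j)
  have hnorm : ∀ z : halfShell X l r, ‖z.1‖ = r := fun z =>
    (mem_shell.1 (Finset.mem_filter.1 z.2).1).2
  have hr := h.left_pos
  refine ⟨f, hf0, ?_, ?_⟩
  · have h1 : ∑ z : halfShell X l r, f z * r ^ 2 = 0 := by
      rw [Finset.sum_congr rfl fun z _ => by
        rw [← hnorm z, EuclideanSpace.real_norm_sq_eq, Finset.mul_sum], Finset.sum_comm]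
      exact Finset.sum_eq_zero fun i _ => by simpa [sq] using hT i i
    rw [← Finset.sum_mul, mul_eq_zero] at h1
    exact h1.resolve_right (by positivity)
  · intro x
    have h1 : ∀ z : halfShell X l r, f z * cosSq x z =
        ∑ i, ∑ j, x i * x j / (‖x‖ * r) ^ 2 * (f z * (z.1 i * z.1 j)) := by
      intro z
      rw [cosSq, hnorm z, div_pow, sq ⟪x, z.1⟫, PiLp.inner_apply, Finset.sum_mul_sum,
        Finset.sum_div, Finset.mul_sum]
      refine Finset.sum_congr rfl fun i _ => ?_
      rw [Finset.sum_div, Finset.mul_sum]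
      refine Finset.sum_congr rfl fun j _ => ?_
      simp only [RCLike.inner_apply, conj_trivial]
      ring
    rw [Finset.sum_congr rfl fun z _ => h1 z, Finset.sum_comm]
    refine Finset.sum_eq_zero fun i _ => ?_
    rw [Finset.sum_comm]
    refine Finset.sum_eq_zero fun j _ => ?_
    rw [← Finset.mul_sum, hT i j, mul_zero]

/-- The eigenvalue of the Seidel type matrix of a shell is an integer. -/
lemma Shells.exists_int (h : Shells X w r ρ) (hn : 8 ≤ n) :
    ∃ y : ℤ, 0 ≤ y ∧ (y : ℝ) ^ 2 * disc n (param X w r ρ) =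
      ((2 * n + 2) * param X w r ρ + 1) ^ 2 := by
  classical
  have hn8 : (8 : ℝ) ≤ n := by exact_mod_cast hn
  obtain ⟨l, hl⟩ := exists_inner_ne_zero X
  have ha3 := h.third_le_param (by omega)
  have hcard : n ^ 2 < (halfShell X l r).card := by
    have h1 := h.le_card
    rw [h.card_shell_eq hl] at h1
    push_cast at h1
    have : ((n ^ 2 : ℕ) : ℝ) < ((halfShell X l r).card : ℕ) := by
      push_cast
      nlinarith
    exact_mod_cast this
  obtain ⟨f, hf0, hfs, hfc⟩ := h.exists_relation hcard
  obtain ⟨a, ha⟩ := h.exists_rat_param (by omega)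
  obtain ⟨d, hd⟩ := h.exists_rat_sqrt_disc hn
  have hdisc := disc_pos (n := n) (by linarith) (param X w r ρ)
  have hδ := Real.sqrt_pos.2 hdisc
  set δ := √(disc n (param X w r ρ)) with hδdef
  set b := param X w r ρ with hb
  let v : Rn n → Rn n → ℝ := fun x z => 2 * (n + 4) * b * cosSq x z - (6 * b - 1)
  -- By construction δ A = ((2n + 2)b + 1) I - v, and v combines the matrix of squared cosines with
  -- the all-ones matrix, both of which annihilate f.
  let A : Matrix (halfShell X l r) (halfShell X l r) ℤ := fun x z =>
    if x = z then 0 else if v x z = δ then -1 else 1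
  have hAv : ∀ x z : halfShell X l r, (A x z : ℝ) * δ =
      (if x = z then (2 * n + 2) * b + 1 else 0) - v x z := by
    intro x z
    have hx := (Finset.mem_filter.1 x.2).1
    have hz := (Finset.mem_filter.1 z.2).1
    by_cases hxz : x = z
    · subst hxz
      simp only [A, v, if_true, cosSq_self (h.ne_zero hx)]
      push_cast
      ring
    · have hne : z.1 ≠ x.1 := fun he => hxz (Subtype.ext he.symm)
      have hsq : v x z ^ 2 = δ ^ 2 := h.sq_eq_disc hx hz hne (Shells.mem_halfShell_ne_neg x.2 z.2)
      simp only [A, if_neg hxz]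
      by_cases hvd : v x z = δ
      · rw [if_pos hvd, hvd]; push_cast; ring
      · rw [if_neg hvd, (sq_eq_sq_iff_eq_or_eq_neg.1 hsq).resolve_left hvd]; push_cast; ring
  have heig : (A.map (Int.cast : ℤ → ℝ)).mulVec f = (((2 * n + 2) * b + 1) / δ) • f := by
    ext x
    rw [Pi.smul_apply, smul_eq_mul, div_mul_eq_mul_div, eq_div_iff hδ.ne', Matrix.mulVec,
      dotProduct, Finset.sum_mul]
    have h1 : ∀ z : halfShell X l r, A.map (Int.cast : ℤ → ℝ) x z * f z * δ =
        (if x = z then ((2 * n + 2) * b + 1) * f z else 0) -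
          2 * (n + 4) * b * (f z * cosSq x.1 z.1) + (6 * b - 1) * f z := by
      intro z
      rw [Matrix.map_apply, mul_right_comm, hAv x z]
      simp only [v]
      split_ifs <;> ring
    rw [Finset.sum_congr rfl fun z _ => h1 z, Finset.sum_add_distrib, Finset.sum_sub_distrib,
      ← Finset.mul_sum, ← Finset.mul_sum, hfc, hfs, Finset.sum_ite_eq, if_pos (Finset.mem_univ x)]
    ring
  obtain ⟨y, hy⟩ := exists_int_of_eigenvalue A hf0 heig
    ⟨((2 * n + 2) * a + 1) / d, by push_cast; rw [← ha, ← hd]⟩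
  refine ⟨y, ?_, ?_⟩
  · have : (0 : ℝ) ≤ y := by
      rw [← hy]
      exact div_nonneg (by nlinarith) hδ.le
    exact_mod_cast this
  · rw [← hy, ← Real.sq_sqrt hdisc.le, ← hδdef]
    field_simp

/-- No tight design exists in dimension at least three. -/
lemma Shells.not_three_le (h : Shells X w r ρ) : ¬ 3 ≤ n := by
  intro hn
  obtain ⟨t, ht⟩ := h.exists_mul_eq hn
  have h8 : 8 ≤ n := by
    rcases eq_or_le_of_mul_eq_six_mul_sq hn ht with hh | hh <;> omega
  have ht' : ((n : ℝ) + 1) * (n + 2) = 6 * t ^ 2 := by exact_mod_cast ht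
  -- `EigenRel` is the relation of `Shells.exists_int` divided by 24(n + 1)/(n + 2), with (n + 1)(n
  -- + 2) replaced by 6t².
  have key : ∀ a y : ℝ, y ^ 2 * disc n a = ((2 * n + 2) * a + 1) ^ 2 → EigenRel n t y a := by
    intro a y hy
    rw [disc] at hy
    rw [EigenRel]
    have hc : (24 * ((n : ℝ) + 1) / (n + 2)) ≠ 0 := by positivity
    apply mul_left_cancel₀ hc
    have e : y ^ 2 * (24 * ((n : ℝ) + 1) / (n + 2) * (a ^ 2 - a / 3 + (n + 2) / (24 * (n + 1)))) =
      24 * ((n : ℝ) + 1) / (n + 2) * (y ^ 2 * (a ^ 2 - a / 3 + (n + 2) / (24 * (n + 1)))) := by ring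
    rw [← e, hy]
    field_simp
    linear_combination 24 * ((n : ℝ) + 1) * a ^ 2 * ht'
  obtain ⟨y, hy0, hy⟩ := h.exists_int h8
  obtain ⟨z, hz0, hz⟩ := h.symm.exists_int h8
  exact not_eigenRel hn ht (h.third_le_param hn) (h.symm.third_le_param hn) h.param_add
    (key _ _ hy) (key _ _ hz) hy0 hz0

end shells

end EuclideanDesign

theorem corollary1p2 (n : ℕ) (hn : 2 ≤ n)
    (X : Finset (EuclideanDesign.Rn n)) (w : EuclideanDesign.Rn n → ℝ)
    (hX : EuclideanDesign.IsTightOfSpace 9 X w) (h0 : (0 : EuclideanDesign.Rn n) ∈ X) :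
    n = 2 ∧ EuclideanDesign.numSpheres X = 3 ∧
      ∃ r₁ r₂ w₁ : ℝ, 0 < r₁ ∧ 0 < r₂ ∧ r₁ ≠ r₂ ∧ 0 < w₁ ∧
        EuclideanDesign.Similar ((X : Set (EuclideanDesign.Rn n)) \ {0}) w
          (EuclideanDesign.octagon₁ r₁ ∪ EuclideanDesign.octagon₂ r₂)
          (EuclideanDesign.octagonWeight r₁ r₂ w₁) := by
  obtain ⟨r, ρ, h⟩ := (EuclideanDesign.Tight.of_isTightOfSpace (by omega) hX h0).exists_shells
  have h2 : n = 2 := by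
    have := h.not_three_le
    omega
  subst h2
  exact ⟨rfl, h.numSpheres_eq, r, ρ, _, h.left_pos, h.right_pos, h.ne,
    div_pos h.mass_pos (by norm_num), h.similar⟩
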